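/- Fix $0<R'<\tau$, $T\ge\tau+R'$ and $s\in(1,2)$. For $u\in L^2(0,T)$ and $\theta_0\in L^2(0,1)$, a solution of $$\theta_t-\theta_{xx}=0 \text{ on } (0,T)\times(0,1),\qquad \theta_x(t,0)=0,\qquad \theta_x(t,1)=u(t),\qquad \theta(0,\cdot)=\theta_0,$$ is a function $\theta\in C([0,T];L^2(0,1))$ with $\theta(0)=\theta_0$ such that for every $\varphi\in C^2([0,1])$ with $\varphi'(0)=\varphi'(1)=0$ and every $t\in[0,T]$, $$\int_0^1\theta(t,x)\varphi(x)\,dx=\int_0^1\theta_0\varphi\,dx+\int_0^t\Bigl(\int_0^1\theta(r,x)\varphi''(x)\,dx+u(r)\varphi(1)\Bigr)dr .$$ Let $\phi_s(t)=1$ for $t\le 0$, $\phi_s(t)=0$ for $t\ge 1$, and $\phi_s(t)=\dfrac{e^{-(1-t)^{-\kappa}}}{e^{-(1-t)^{-\kappa}}+e^{-t^{-\kappa}}}$ for $0<t<1$, where $\kappa=(s-1)^{-1}$. For $\theta_0\in L^2(0,1)$ with cosine expansion $\theta_0(x)=\sum_{n\ge0}c_n\sqrt2\cos(n\pi x)$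 in $L^2(0,1)$, put $$y_k=\sqrt2\Bigl(\sum_{n\ge0}c_ne^{-n^2\pi^2\tau}n^{2k}\Bigr)(-\pi^2)^k,\qquad y(t)=\phi_s\Bigl(\frac{t-\tau}{R'}\Bigr)\sum_{k\ge0}y_k\frac{(t-\tau)^k}{k!}$$ (so $y=0$ on $[\tau+R',T]$), and define the exact control by $u(t)=0$ for $0\le t\le\tau$ and $u(t)=\sum_{i\ge1}\frac{y^{(i)}(t)}{(2i-1)!}$ for $\tau<t\le T$. For $\bar\imath,\bar k,\bar n\in\mathbb N$ let $$\overline{y_k}=\sqrt2\Bigl(\sum_{0\le n\le\bar n}c_ne^{-n^2\pi^2\tau}n^{2k}\Bigr)(-\pi^2)^k,\qquad \overline y(t)=\phi_s\Bigl(\frac{t-\tau}{R'}\Bigr)\sum_{0\le k\le\bar k}\overline{y_k}\frac{(t-\tau)^k}{k!},$$ and define the truncated control by $\overline u(t)=0$ for $0\le t\le\tau$ and $\overline u(t)=\sum_{1\le i\le\bar\imath}\frac{\overline y^{(i)}(t)}{(2i-1)!}$ for $\tau<t\le T$. Then there exist positive constants $C,C_1,C_2,C_3$ (depending only on $T,\tau,R',s$)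 such that for all $\theta_0\in L^2(0,1)$: the series defining $y_k$ (for every $k$), $y$ (on $[\tau,\tau+R']$) and $u$ (on $[\tau,T]$) converge, $y$ is $C^\infty$ on $[\tau,T]$, and the system has a solution $\theta$ with control $u$ starting from $\theta_0$; and for all $\bar\imath,\bar k,\bar n\in\mathbb N$ it has a solution $\hat\theta$ with control $\overline u$ starting from $\theta_0$, and any such $\theta$ and $\hat\theta$ satisfy, for all $t\in[\tau,T]$, $$\|\theta(t)-\hat\theta(t)\|_{L^\infty(0,1)}\le C\left(e^{-C_1\,\bar\imath\ln\bar\imath}+e^{-C_2\,\bar k}+e^{-C_3\,\bar n^2}\right)\|\theta_0\|_{L^2(0,1)},$$ where $0\ln0=0$. -/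

import Mathlib

open MeasureTheory Set

noncomputable section

namespace HeatFlat

/-- Lebesgue measure on the interval `(0,1)`. -/
abbrev unitMeasure : Measure ℝ := volume.restrict (Ioo (0 : ℝ) 1)

/-- The real Hilbert space `L²(0,1)`. -/
abbrev L2 : Type := Lp ℝ 2 unitMeasure

/-- `θ` is the (weak) solution on `[0,T]` of the controlled heat equation
`θ_t = θ_xx` on `(0,T) × (0,1)`, `θ_x(t,0) = 0`, `θ_x(t,1) = u(t)`, `θ(0,·) = θ₀`,
with control `u ∈ L²(0,T)` and initial state `θ₀ ∈ L²(0,1)`: `θ ∈ C([0,T]; L²(0,1))`, `θ(0) = θ₀`,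
and the equation holds, integrated in time, against every `C²` test function `φ` on `[0,1]` with
`φ'(0) = φ'(1) = 0`. -/
structure IsHeatSolution (T : ℝ) (u : ℝ → ℝ) (θ₀ : L2) (θ : ℝ → L2) : Prop where
  control_memLp : MemLp u 2 (volume.restrict (Ioo (0 : ℝ) T))
  continuousOn : ContinuousOn θ (Icc 0 T)
  initial : θ 0 = θ₀
  weak : ∀ φ : ℝ → ℝ, ContDiff ℝ 2 φ → deriv φ 0 = 0 → deriv φ 1 = 0 → ∀ t ∈ Icc (0 : ℝ) T,
    ∫ x in Ioo (0 : ℝ) 1, θ t x * φ x =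
      (∫ x in Ioo (0 : ℝ) 1, θ₀ x * φ x) +
        ∫ r in (0 : ℝ)..t,
          ((∫ x in Ioo (0 : ℝ) 1, θ r x * deriv (deriv φ) x) + u r * φ 1)

/-- The Gevrey step function `φ_s`, with `k = (s - 1)⁻¹`. -/
def step (s t : ℝ) : ℝ :=
  if t ≤ 0 then 1
  else if 1 ≤ t then 0
  else Real.exp (-(1 - t) ^ (-(s - 1)⁻¹)) /
    (Real.exp (-(1 - t) ^ (-(s - 1)⁻¹)) + Real.exp (-t ^ (-(s - 1)⁻¹)))

/-- The coefficients `c_n` of the cosine expansion `θ₀ = ∑_{n ≥ 0} c_n √2 cos(nπx)` in `L²(0,1)`.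
The same factor `√2` is used for `n = 0`, hence the separate formula for `c_0`. -/
def cosCoeff (θ₀ : L2) (n : ℕ) : ℝ :=
  if n = 0 then (∫ x in Ioo (0 : ℝ) 1, θ₀ x) / √2
  else √2 * ∫ x in Ioo (0 : ℝ) 1, θ₀ x * Real.cos (n * Real.pi * x)

/-- The summand `c_n e^{-n²π²τ} n^{2k}` in the definition of `y_k`. -/
def outputCoeffTerm (τ : ℝ) (θ₀ : L2) (k n : ℕ) : ℝ :=
  cosCoeff θ₀ n * Real.exp (-(n : ℝ) ^ 2 * Real.pi ^ 2 * τ) * (n : ℝ) ^ (2 * k)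

/-- `y_k = √2 (∑_{n ≥ 0} c_n e^{-n²π²τ} n^{2k}) (-π²)^k`. -/
def outputCoeff (τ : ℝ) (θ₀ : L2) (k : ℕ) : ℝ :=
  √2 * (∑' n : ℕ, outputCoeffTerm τ θ₀ k n) * (-Real.pi ^ 2) ^ k

/-- The truncation of `y_k` to the modes `0 ≤ n ≤ N`. -/
def truncOutputCoeff (τ : ℝ) (θ₀ : L2) (N k : ℕ) : ℝ :=
  √2 * (∑ n ∈ Finset.range (N + 1), outputCoeffTerm τ θ₀ k n) * (-Real.pi ^ 2) ^ k

/-- The flat output `y(t) = φ_s((t-τ)/R') ∑_{k ≥ 0} y_k (t-τ)^k / k!`; it vanishes for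
`t ≥ τ + R'` because the step function does. -/
def flatOutput (s τ R' : ℝ) (θ₀ : L2) (t : ℝ) : ℝ :=
  step s ((t - τ) / R') * ∑' k : ℕ, outputCoeff τ θ₀ k * (t - τ) ^ k / (k.factorial : ℝ)

/-- The truncated flat output, with `0 ≤ k ≤ K` and `y_k` truncated to `0 ≤ n ≤ N`. -/
def truncFlatOutput (s τ R' : ℝ) (θ₀ : L2) (K N : ℕ) (t : ℝ) : ℝ :=
  step s ((t - τ) / R') *
    ∑ k ∈ Finset.range (K + 1), truncOutputCoeff τ θ₀ N k * (t - τ) ^ k / (k.factorial : ℝ)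

/-- The exact control: `0` up to time `τ`, then `∑_{i ≥ 1} y^{(i)}(t) / (2i-1)!`
(the index is shifted by one). -/
def control (s τ R' : ℝ) (θ₀ : L2) (t : ℝ) : ℝ :=
  if t ≤ τ then 0
  else ∑' i : ℕ, iteratedDeriv (i + 1) (flatOutput s τ R' θ₀) t / ((2 * i + 1).factorial : ℝ)

/-- The truncated control: `0` up to time `τ`, then `∑_{1 ≤ i ≤ I} ȳ^{(i)}(t) / (2i-1)!`, where
`ȳ` is the truncated flat output (the index is shifted by one). -/
def truncControl (s τ R' : ℝ) (θ₀ : L2) (I K N : ℕ) (t : ℝ) : ℝ :=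
  if t ≤ τ then 0
  else ∑ i ∈ Finset.range I,
    iteratedDeriv (i + 1) (truncFlatOutput s τ R' θ₀ K N) t / ((2 * i + 1).factorial : ℝ)

/-- The exact control is given by genuinely convergent series and genuine derivatives. -/
structure ControlWellDefined (T s τ R' : ℝ) (θ₀ : L2) : Prop where
  summable_coeff : ∀ k : ℕ, Summable (outputCoeffTerm τ θ₀ k)
  summable_output : ∀ t ∈ Icc τ (τ + R'),
    Summable fun k : ℕ => outputCoeff τ θ₀ k * (t - τ) ^ k / (k.factorial : ℝ)
  smooth_output : ∀ t ∈ Icc τ T, ContDiffAt ℝ (⊤ : ℕ∞) (flatOutput s τ R' θ₀) t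
  summable_control : ∀ t ∈ Icc τ T, Summable fun i : ℕ =>
    iteratedDeriv (i + 1) (flatOutput s τ R' θ₀) t / ((2 * i + 1).factorial : ℝ)

end HeatFlat

end

namespace HeatFlat

open Filter Topology

/-! ### Real derivatives of restrictions of holomorphic functions -/

/-! The difference of the two solutions starts from zero and is driven by the difference of the
controls. Each cosine mode of it solves a scalar equation `a' = -n²π² a + β v` with `|β| ≤ √2`, so
it is at most a constant times `sup |v| / n²` for `n ≥ 1`. This is summable in `n`, hence the sup
norm of the state is controlled by the sup norm of `v` (`eLpNorm_sub_le`), and everything reduces to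
a uniform bound on the control error (`control_estimates`).

Fix radii `R' < ρ' < ρ < τ`. Splitting `e^{-xτ} = e^{-xρ} e^{-x(τ-ρ)}` with `x = n²π²` bounds `y_k`
by a multiple of `k!/ρ^k`, with Gaussian decay left over for the modes beyond `N`. Measuring
coefficients against `k!/ρ'^k` instead makes those beyond `K` cost `(ρ'/ρ)^K`. Since `ρ' > R'`, the
power series is holomorphic near `[τ, τ+R']`. Multiplied by a step function that is Gevrey of order
`s`, it has `i`-th derivative at most `A C₀ M^i (i!)^s`, linearly in the size `A` of the
coefficients (`cutoffSeries_gevrey`). Because `(i!)² ≤ 2^i (2i-1)!` and `s < 2`, the control series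
converges like `∑ (2M)^i / (i!)^(2-s)`, and cutting it at `I` costs `e^{-c I ln I}`.

The Gevrey bound on the step comes from Cauchy's estimates: near `0`, `1 - φ_s` extends
holomorphically to discs of radius proportional to `t` about `t`, with size `e^{-t^{-κ}/2}` there.
-/

theorem iteratedDeriv_re_ofReal (k : ℕ) {F : ℂ → ℂ} {x : ℝ} (hF : AnalyticAt ℂ F x) :
    iteratedDeriv k (fun t : ℝ => (F t).re) x = (iteratedDeriv k F x).re := by
  induction k generalizing F with
  | zero => simp
  | succ k ih =>
    rw [iteratedDeriv_succ', iteratedDeriv_succ', ← ih hF.deriv]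
    apply Filter.EventuallyEq.iteratedDeriv_eq
    have h := Complex.continuous_ofReal.continuousAt.eventually hF.eventually_analyticAt
    filter_upwards [h] with t ht
    exact (ht.differentiableAt.hasDerivAt.real_of_complex).deriv

/-- Cauchy's estimates carried to the real line. The radius may depend on the point, which is needed
for the step function near `0`. -/
theorem abs_iteratedDeriv_re_le {F : ℂ → ℂ} {f : ℝ → ℝ} {x r B : ℝ} (hr : 0 < r)
    (hF : ∀ z : ℂ, ‖z - x‖ ≤ r → DifferentiableAt ℂ F z ∧ ‖F z‖ ≤ B)
    (hf : ∀ᶠ t in 𝓝 x, f t = (F t).re) :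
    ContDiffAt ℝ (⊤ : ℕ∞) f x ∧
      ∀ k : ℕ, |iteratedDeriv k f x| ≤ k.factorial * B / r ^ k := by
  have hd : DifferentiableOn ℂ F (Metric.closedBall (x : ℂ) r) := fun z hz =>
    (hF z (by simpa [dist_eq_norm] using hz)).1.differentiableWithinAt
  have han : AnalyticAt ℂ F x :=
    hd.analyticAt (Metric.closedBall_mem_nhds _ hr)
  refine ⟨han.re_ofReal.contDiffAt.congr_of_eventuallyEq hf, fun k => ?_⟩
  rw [Filter.EventuallyEq.iteratedDeriv_eq k hf, iteratedDeriv_re_ofReal k han]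
  refine (Complex.abs_re_le_norm _).trans ?_
  refine Complex.norm_iteratedDeriv_le_of_forall_mem_sphere_norm_le k hr
    (hd.diffContOnCl_ball subset_rfl) fun z hz => (hF z ?_).2
  simpa [dist_eq_norm] using hz.le

theorem contDiffAt_iteratedDeriv (k : ℕ) {f : ℝ → ℝ} {x : ℝ} (hf : ContDiffAt ℝ (⊤ : ℕ∞) f x) :
    ContDiffAt ℝ (⊤ : ℕ∞) (iteratedDeriv k f) x := by
  induction k generalizing f with
  | zero => simpa using hf
  | succ k ih =>
    rw [iteratedDeriv_succ']
    exact ih ((hf.fderiv_right (m := (⊤ : ℕ∞)) (by simp)).clm_apply contDiffAt_const)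

/-! ### Gluing a flat function with zero -/

/-- A quadratic bound on the `k`-th derivative to the right of `0` makes its difference quotient at
`0` vanish in the limit, so all derivatives extend by zero, by induction on `k`. -/
theorem contDiffAt_of_flat {h : ℝ → ℝ} {b : ℝ} (hb : 0 < b) (h0 : ∀ x ≤ 0, h x = 0)
    (hs : ∀ x ∈ Ioo 0 b, ContDiffAt ℝ (⊤ : ℕ∞) h x)
    (hB : ∀ k : ℕ, ∃ C, ∀ x ∈ Ioo 0 b, |iteratedDeriv k h x| ≤ C * x ^ 2) :
    (∀ x < b, ContDiffAt ℝ (⊤ : ℕ∞) h x) ∧ ∀ k, ∀ x ≤ 0, iteratedDeriv k h x = 0 := by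
  have key : ∀ k, (∀ x ≤ 0, iteratedDeriv k h x = 0) →
      ∀ x ≤ 0, HasDerivAt (iteratedDeriv k h) 0 x := by
    intro k hk x hx
    rcases hx.lt_or_eq with hx | rfl
    · refine (hasDerivAt_const x (0 : ℝ)).congr_of_eventuallyEq ?_
      filter_upwards [Iio_mem_nhds hx] with y hy using hk y hy.le
    · obtain ⟨C, hC⟩ := hB k
      rw [hasDerivAt_iff_isLittleO]
      have h1 : (fun x' : ℝ => iteratedDeriv k h x' - iteratedDeriv k h 0 - (x' - 0) • (0 : ℝ))
          =O[𝓝 0] fun x' : ℝ => x' ^ 2 := by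
        refine Asymptotics.IsBigO.of_bound |C| ?_
        filter_upwards [Iio_mem_nhds hb] with y hy
        rw [hk 0 le_rfl]
        rcases le_or_gt y 0 with hy0 | hy0
        · rw [hk y hy0]; simp; positivity
        · simp only [sub_zero, smul_zero, Real.norm_eq_abs, abs_pow, sq_abs]
          exact (hC y ⟨hy0, hy⟩).trans (by gcongr; exact le_abs_self C)
      have h2 : (fun x' : ℝ => x' ^ 2) =o[𝓝 0] fun x' : ℝ => x' - 0 := by
        simpa using Asymptotics.isLittleO_pow_pow (𝕜 := ℝ) (m := 1) (n := 2) (by norm_num)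
      exact h1.trans_isLittleO h2
  have hz : ∀ k, ∀ x ≤ 0, iteratedDeriv k h x = 0 := by
    intro k
    induction k with
    | zero => simpa using h0
    | succ k ih =>
      intro x hx
      rw [iteratedDeriv_succ]
      exact (key k ih x hx).deriv
  refine ⟨?_, hz⟩
  have hon : ContDiffOn ℝ ((⊤ : ℕ∞) : WithTop ℕ∞) h (Iio b) := by
    apply contDiffOn_of_differentiableOn_deriv
    intro m _ x hx
    have hc : Set.EqOn (iteratedDerivWithin m h (Iio b)) (iteratedDeriv m h) (Iio b) :=
      iteratedDerivWithin_of_isOpen isOpen_Iio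
    refine DifferentiableWithinAt.congr ?_ hc (hc hx)
    apply DifferentiableAt.differentiableWithinAt
    rcases le_or_gt x 0 with hx0 | hx0
    · exact (key m (hz m) x hx0).differentiableAt
    · exact (contDiffAt_iteratedDeriv m (hs x ⟨hx0, hx⟩)).differentiableAt (by simp)
  exact fun x hx => hon.contDiffAt (Iio_mem_nhds hx)

/-! ### Elementary decay estimates -/

/-- `x^{-j} e^{-c x^{-κ}}` is at most `(j!)^{1/κ} (κ c)^{-j/κ}`. -/
theorem exp_neg_rpow_le {κ c x : ℝ} (hκ : 0 < κ) (hc : 0 < c) (hx : 0 < x) (j : ℕ) :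
    Real.exp (-(c * x ^ (-κ))) ≤
      x ^ j * (((κ * c) ^ (-κ⁻¹)) ^ j * (j.factorial : ℝ) ^ κ⁻¹) := by
  -- The argument carries an extra factor `κ` because the inequality is then raised to the power
  -- `1/κ`.
  have h1 := Real.pow_div_factorial_le_exp (κ * c * x ^ (-κ)) (by positivity) j
  have h2 : ((κ * c * x ^ (-κ)) ^ j / j.factorial) ^ κ⁻¹ ≤ Real.exp (c * x ^ (-κ)) := by
    refine (Real.rpow_le_rpow (by positivity) h1 (by positivity)).trans_eq ?_
    rw [← Real.exp_mul]
    congr 1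
    field_simp
  have h3 : ((κ * c * x ^ (-κ)) ^ j / j.factorial) ^ κ⁻¹ =
      ((κ * c) ^ κ⁻¹) ^ j * (x ^ j)⁻¹ / (j.factorial : ℝ) ^ κ⁻¹ := by
    rw [Real.div_rpow (by positivity) (by positivity), mul_pow, Real.mul_rpow (by positivity)
      (by positivity), ← Real.rpow_natCast (x ^ (-κ)), ← Real.rpow_mul hx.le,
      ← Real.rpow_mul hx.le, ← Real.rpow_natCast (κ * c), ← Real.rpow_mul (by positivity),
      ← Real.rpow_natCast ((κ * c) ^ κ⁻¹), ← Real.rpow_mul (by positivity), mul_comm κ⁻¹,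
      show -κ * (j : ℝ) * κ⁻¹ = -(j : ℝ) by field_simp, Real.rpow_neg hx.le, Real.rpow_natCast]
  rw [h3] at h2
  rw [Real.exp_neg, Real.rpow_neg (x := κ * c) (by positivity), inv_pow]
  refine (inv_anti₀ (by positivity) h2).trans_eq ?_
  field_simp

/-- Keeps the denominator of `stepCompl` away from zero. If `|Im w| ≤ π/2`, then `e^w` has
nonnegative real part and adding `1` only lengthens it; if `Re w ≥ 1`, then `|e^w| ≥ 2` and
subtracting `1` loses at most half. -/
theorem half_exp_re_le_norm_one_add_exp {w : ℂ} (h : |w.im| ≤ Real.pi / 2 ∨ 1 ≤ w.re) :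
    Real.exp w.re / 2 ≤ ‖1 + Complex.exp w‖ := by
  rcases h with h | h
  · have hc : 0 ≤ (Complex.exp w).re := by
      rw [Complex.exp_re]
      exact mul_nonneg (Real.exp_pos _).le
        (Real.cos_nonneg_of_mem_Icc ⟨by linarith [abs_le.1 h], by linarith [abs_le.1 h]⟩)
    have h2 : ‖Complex.exp w‖ ≤ ‖1 + Complex.exp w‖ := by
      rw [← sq_le_sq₀ (norm_nonneg _) (norm_nonneg _), Complex.sq_norm, Complex.sq_norm,
        Complex.normSq_apply, Complex.normSq_apply]
      simp only [Complex.add_re, Complex.one_re, Complex.add_im, Complex.one_im]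
      nlinarith
    rw [Complex.norm_exp] at h2
    linarith [Real.exp_pos w.re]
  · have h2 : ‖Complex.exp w‖ - ‖(1 : ℂ)‖ ≤ ‖1 + Complex.exp w‖ := by
      rw [add_comm]; simpa using norm_sub_norm_le (Complex.exp w) (-1)
    rw [Complex.norm_exp, norm_one] at h2
    have : 1 + w.re ≤ Real.exp w.re := by linarith [Real.add_one_le_exp w.re]
    linarith

/-! ### The Gevrey step function -/

/-- The exponent `z^{-κ} - (1-z)^{-κ}`. -/
noncomputable def stepExponent (κ : ℝ) (z : ℂ) : ℂ :=
  Complex.exp (-κ * Complex.log z) - Complex.exp (-κ * Complex.log (1 - z))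

/-- The holomorphic extension of `1 - φ_s` near the interval `(0,1)`. -/
noncomputable def stepCompl (κ : ℝ) (z : ℂ) : ℂ := 1 / (1 + Complex.exp (stepExponent κ z))

theorem exp_log_ofReal {κ t : ℝ} (ht : 0 < t) :
    Complex.exp (-κ * Complex.log t) = ((t ^ (-κ) : ℝ) : ℂ) := by
  rw [Real.rpow_def_of_pos ht, Complex.ofReal_exp, ← Complex.ofReal_log ht.le]
  push_cast
  ring_nf

theorem stepCompl_ofReal {κ t : ℝ} (ht : t ∈ Ioo (0 : ℝ) 1) :
    stepCompl κ t = ((1 / (1 + Real.exp (t ^ (-κ) - (1 - t) ^ (-κ))) : ℝ) : ℂ) := by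
  have h1 : (1 : ℂ) - t = ((1 - t : ℝ) : ℂ) := by push_cast; rfl
  rw [stepCompl, stepExponent, h1, exp_log_ofReal ht.1, exp_log_ofReal (by linarith [ht.2])]
  push_cast
  rfl

theorem one_sub_step_eq {s t : ℝ} (ht : t ∈ Ioo (0 : ℝ) 1) :
    1 - step s t = (stepCompl (s - 1)⁻¹ t).re := by
  rw [stepCompl_ofReal ht, Complex.ofReal_re, step, if_neg (not_le.2 ht.1), if_neg (not_le.2 ht.2),
    Real.exp_sub]
  rw [Real.exp_neg, Real.exp_neg]
  have h1 := Real.exp_pos (t ^ (-(s - 1)⁻¹))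
  have h2 := Real.exp_pos ((1 - t) ^ (-(s - 1)⁻¹))
  field_simp
  ring

theorem exp_log_ofReal_mul {κ a : ℝ} {ζ : ℂ} (ha : 0 < a) (hζ : ‖ζ‖ < 1) :
    Complex.exp (-κ * Complex.log (a * (1 + ζ))) =
      ((a ^ (-κ) : ℝ) : ℂ) * Complex.exp (-κ * Complex.log (1 + ζ)) := by
  have hne : 1 + ζ ≠ 0 := by
    intro h
    have : ζ = -1 := by linear_combination h
    rw [this] at hζ
    simp at hζ
  rw [Complex.log_ofReal_mul ha hne, mul_add, Complex.exp_add, Complex.ofReal_log ha.le,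
    exp_log_ofReal ha]

theorem norm_exp_log_sub_le {κ η a : ℝ} {ζ z : ℂ} (ha : 0 < a) (hζ : ‖ζ‖ < 1)
    (h : ‖Complex.exp (-κ * Complex.log (1 + ζ)) - 1‖ ≤ η) (hz : z = a * (1 + ζ)) :
    ‖Complex.exp (-κ * Complex.log z) - ((a ^ (-κ) : ℝ) : ℂ)‖ ≤ η * a ^ (-κ) := by
  rw [hz, exp_log_ofReal_mul ha hζ,
    show ∀ p q : ℂ, p * q - p = p * (q - 1) by intros; ring, norm_mul, Complex.norm_real,
    Real.norm_of_nonneg (by positivity), mul_comm]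
  gcongr

theorem exists_exp_log_near_one (κ : ℝ) {η : ℝ} (hη : 0 < η) :
    ∃ r ∈ Ioo (0 : ℝ) 1, ∀ ζ : ℂ, ‖ζ‖ ≤ r →
      ‖Complex.exp (-κ * Complex.log (1 + ζ)) - 1‖ ≤ η := by
  have hc : ContinuousAt (fun ζ : ℂ => Complex.exp (-κ * Complex.log (1 + ζ)) - 1) 0 := by
    have : ContinuousAt (fun ζ : ℂ => Complex.log (1 + ζ)) 0 :=
      ContinuousAt.clog (by fun_prop) (by simp)
    fun_prop
  obtain ⟨δ, hδ, h⟩ := Metric.continuousAt_iff.1 hc η hη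
  refine ⟨min (δ / 2) (1 / 2), ⟨by positivity, by
    linarith [min_le_right (δ / 2) (1 / 2)]⟩, fun ζ hζ => ?_⟩
  have := h (x := ζ) (by
    rw [dist_zero_right]; linarith [min_le_left (δ / 2) (1 / 2)])
  simpa [dist_eq_norm] using this.le

/-- On the disc of radius `r t`, write `z = t (1 + ζ)` with `|ζ| ≤ r`: by homogeneity `z^{-κ}`
differs from `t^{-κ}` by a small relative error. The same holds for `1 - z`, as `t ≤ 1 - t`. So the
exponent has real part at least `t^{-κ}/2` up to a constant. -/
theorem stepCompl_bound {κ : ℝ} (hκ : 0 < κ) :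
    ∃ r ∈ Ioo (0 : ℝ) 1, ∃ B : ℝ, 0 < B ∧ ∀ t ∈ Ioc (0 : ℝ) (1 / 2), ∀ z : ℂ, ‖z - t‖ ≤ r * t →
      DifferentiableAt ℂ (stepCompl κ) z ∧
        ‖stepCompl κ z‖ ≤ B * Real.exp (-(1 / 2 * t ^ (-κ))) := by
  set q : ℝ := (2 : ℝ) ^ κ with hq
  have hq0 : 0 < q := by positivity
  -- The bound `1/2` leaves `Re w ≥ P/2 - 2q`. The other bound ensures that `η (P + Q) > π/2` forces
  -- `P + Q > 2 + 5q`, hence `P > 2 + 4q` and `Re w ≥ 1`.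
  set η : ℝ := min (1 / 2) (Real.pi / 4 / (1 + 5 / 2 * q)) with hη
  have hη0 : 0 < η := by have := Real.pi_pos; positivity
  have hη1 : η ≤ 1 / 2 := min_le_left _ _
  have hη2 : η * (1 + 5 / 2 * q) ≤ Real.pi / 4 := by
    rw [← le_div_iff₀ (by positivity)]; exact min_le_right _ _
  obtain ⟨r, hr, hnear⟩ := exists_exp_log_near_one κ hη0
  refine ⟨r, hr, 2 * Real.exp (2 * q), by positivity, fun t ht z hz => ?_⟩
  have ht0 : (t : ℂ) ≠ 0 := by exact_mod_cast ht.1.ne'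
  have ht1 : 0 < 1 - t := by linarith [ht.2]
  have ht1' : (1 : ℂ) - t ≠ 0 := by exact_mod_cast ht1.ne'
  set ζ : ℂ := (z - t) / t with hζdef
  set ζ' : ℂ := -((z - t) / (1 - t)) with hζdef'
  have hζ : ‖ζ‖ ≤ r := by
    rw [hζdef, norm_div, Complex.norm_real, Real.norm_of_nonneg ht.1.le, div_le_iff₀ ht.1]
    exact hz
  have hζ' : ‖ζ'‖ ≤ r := by
    have : ‖(1 : ℂ) - t‖ = 1 - t := by
      rw [← Complex.ofReal_one, ← Complex.ofReal_sub, Complex.norm_real, Real.norm_of_nonneg ht1.le]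
    rw [hζdef', norm_neg, norm_div, this, div_le_iff₀ ht1]
    refine hz.trans ?_
    have := hr.1
    gcongr
    linarith [ht.2]
  have e1 : z = t * (1 + ζ) := by rw [hζdef]; field_simp; ring
  have e2 : 1 - z = ((1 - t : ℝ) : ℂ) * (1 + ζ') := by
    rw [hζdef']; push_cast; field_simp; ring
  have b1 := norm_exp_log_sub_le ht.1 (hζ.trans_lt hr.2) (hnear ζ hζ) e1
  have b2 := norm_exp_log_sub_le ht1 (hζ'.trans_lt hr.2) (hnear ζ' hζ') e2
  set P : ℝ := t ^ (-κ) with hP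
  set Q : ℝ := (1 - t) ^ (-κ) with hQ
  have hP0 : 0 < P := Real.rpow_pos_of_pos ht.1 _
  have hQ0 : 0 < Q := Real.rpow_pos_of_pos ht1 _
  have hQq : Q ≤ q := by
    have : (1 - t) ^ (-κ) ≤ (1 / 2 : ℝ) ^ (-κ) :=
      Real.rpow_le_rpow_of_nonpos (by norm_num) (by linarith [ht.2]) (by linarith)
    refine this.trans_eq ?_
    rw [hq, one_div, Real.inv_rpow (by norm_num), Real.rpow_neg (by norm_num), inv_inv]
  set w := stepExponent κ z with hw
  have hdiff : ‖w - ((P - Q : ℝ) : ℂ)‖ ≤ η * (P + Q) := by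
    have : w - ((P - Q : ℝ) : ℂ) = (Complex.exp (-κ * Complex.log z) - (P : ℂ)) -
        (Complex.exp (-κ * Complex.log (1 - z)) - (Q : ℂ)) := by
      rw [hw, stepExponent]; push_cast; ring
    rw [this, mul_add]
    exact (norm_sub_le _ _).trans (add_le_add b1 b2)
  have hre : (1 - η) * P - (1 + η) * Q ≤ w.re := by
    have := (abs_le.1 ((Complex.abs_re_le_norm _).trans hdiff)).1
    simp only [Complex.sub_re, Complex.ofReal_re] at this
    nlinarith
  have him : |w.im| ≤ η * (P + Q) := by
    have := (Complex.abs_im_le_norm _).trans hdiff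
    simpa using this
  have hre' : 1 / 2 * P - 2 * q ≤ w.re := by nlinarith
  have hlow : Real.exp w.re / 2 ≤ ‖1 + Complex.exp w‖ := by
    apply half_exp_re_le_norm_one_add_exp
    rcases le_or_gt (η * (P + Q)) (Real.pi / 2) with hle | hgt
    · exact Or.inl (him.trans hle)
    · right
      have h1 : η * (2 * (1 + 5 / 2 * q)) < η * (P + Q) := by nlinarith
      have h2 := lt_of_mul_lt_mul_left h1 hη0.le
      nlinarith
  have hpos : 0 < ‖1 + Complex.exp w‖ := lt_of_lt_of_le (by positivity) hlow
  have hslit : ∀ {ξ : ℂ} {a : ℝ}, 0 < a → ‖ξ‖ ≤ r → (a : ℂ) * (1 + ξ) ∈ Complex.slitPlane := by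
    intro ξ a ha hξ
    left
    have := (abs_le.1 ((Complex.abs_re_le_norm ξ).trans hξ)).1
    rw [Complex.re_ofReal_mul]
    refine mul_pos ha ?_
    simp only [Complex.add_re, Complex.one_re]
    linarith [hr.2]
  constructor
  · have hz1 : z ∈ Complex.slitPlane := by rw [e1]; exact hslit ht.1 hζ
    have hz2 : 1 - z ∈ Complex.slitPlane := by rw [e2]; exact hslit ht1 hζ'
    unfold stepCompl stepExponent
    refine DifferentiableAt.div (by fun_prop) ?_ (norm_pos_iff.1 hpos)
    have d1 : DifferentiableAt ℂ Complex.log z := Complex.differentiableAt_log hz1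
    have d2 : DifferentiableAt ℂ (fun z => Complex.log (1 - z)) z :=
      DifferentiableAt.clog (by fun_prop) hz2
    fun_prop
  · rw [stepCompl, norm_div, norm_one, ← hw]
    have h3 : Real.exp (1 / 2 * P - 2 * q) / 2 ≤ ‖1 + Complex.exp w‖ :=
      le_trans (by gcongr) hlow
    refine (one_div_le_one_div_of_le (by positivity) h3).trans_eq ?_
    rw [Real.exp_sub, Real.exp_neg]
    field_simp

theorem step_of_nonpos {s x : ℝ} (hx : x ≤ 0) : step s x = 1 := if_pos hx

theorem step_of_one_le {s x : ℝ} (hx : 1 ≤ x) : step s x = 0 := by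
  rw [step, if_neg (by linarith), if_pos hx]

/-- This symmetry reduces the right half of the line to the left half. -/
theorem step_one_sub (s x : ℝ) : step s (1 - x) = 1 - step s x := by
  rcases le_or_gt x 0 with hx | hx
  · rw [step_of_nonpos hx, step_of_one_le (by linarith), sub_self]
  rcases le_or_gt 1 x with hx1 | hx1
  · rw [step_of_one_le hx1, step_of_nonpos (by linarith), sub_zero]
  rw [step, step, if_neg (by linarith), if_neg (by linarith), if_neg (by linarith),
    if_neg (by linarith), sub_sub_cancel]
  have h1 := Real.exp_pos (-x ^ (-(s - 1)⁻¹))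
  have h2 := Real.exp_pos (-(1 - x) ^ (-(s - 1)⁻¹))
  field_simp
  ring

/-- `1 - φ_s` is smooth and Gevrey of order `s` on the left half of the line. -/
theorem one_sub_step_gevrey {s : ℝ} (hs : 1 < s) :
    ∃ A M : ℝ, 0 < A ∧ 1 ≤ M ∧ ∀ x ≤ 1 / 2, ContDiffAt ℝ (⊤ : ℕ∞) (fun x => 1 - step s x) x ∧
      ∀ k, |iteratedDeriv k (fun x => 1 - step s x) x| ≤ A * M ^ k * (k.factorial : ℝ) ^ s := by
  set κ := (s - 1)⁻¹ with hκdef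
  have hκ : 0 < κ := inv_pos.2 (by linarith)
  have hκs : κ⁻¹ = s - 1 := by rw [hκdef, inv_inv]
  obtain ⟨r, hr, B, hB, hg⟩ := stepCompl_bound hκ
  set h : ℝ → ℝ := fun x => 1 - step s x with hh
  set m : ℝ := (κ * (1 / 2)) ^ (-κ⁻¹) with hm
  have hm0 : 0 < m := by positivity
  have hr0 := hr.1
  have hloc : ∀ x ∈ Ioc (0 : ℝ) (1 / 2), ContDiffAt ℝ (⊤ : ℕ∞) h x ∧
      ∀ k j : ℕ, |iteratedDeriv k h x| ≤ k.factorial * B / r ^ k *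
        (x ^ j * (m ^ (k + j) * ((k + j).factorial : ℝ) ^ κ⁻¹)) := by
    intro x hx
    have hx0 := hx.1
    have := abs_iteratedDeriv_re_le (f := h) (mul_pos hr.1 hx.1) (hg x hx) (by
      filter_upwards [Ioo_mem_nhds hx.1 (lt_of_le_of_lt hx.2 (by norm_num : (1 / 2 : ℝ) < 1))]
        with t ht using one_sub_step_eq ht)
    refine ⟨this.1, fun k j => (this.2 k).trans ?_⟩
    -- Of the `k + j` powers of `x`, `k` cancel the shrinking Cauchy radius. The remaining `x ^ j`
    -- serves flatness at `0` when `j = 2`; the Gevrey bound takes `j = 0`.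
    have he := exp_neg_rpow_le hκ (by norm_num : (0 : ℝ) < 1 / 2) hx.1 (k + j)
    calc (k.factorial : ℝ) * (B * Real.exp (-(1 / 2 * x ^ (-κ)))) / (r * x) ^ k
        ≤ k.factorial * (B * (x ^ (k + j) * (m ^ (k + j) * ((k + j).factorial : ℝ) ^ κ⁻¹))) /
          (r * x) ^ k := by gcongr
      _ = _ := by rw [mul_pow, pow_add x]; field_simp
  have hflat := contDiffAt_of_flat (h := h) (b := 1 / 2) (by norm_num)
    (fun x hx => by simp [hh, step_of_nonpos hx])
    (fun x hx => (hloc x ⟨hx.1, hx.2.le⟩).1)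
    (fun k => ⟨k.factorial * B / r ^ k * (m ^ (k + 2) * ((k + 2).factorial : ℝ) ^ κ⁻¹),
      fun x hx => ((hloc x ⟨hx.1, hx.2.le⟩).2 k 2).trans_eq (by ring)⟩)
  refine ⟨B, max 1 (m / r), hB, le_max_left _ _, fun x hx => ⟨?_, fun k => ?_⟩⟩
  · rcases hx.lt_or_eq with hx | rfl
    · exact hflat.1 x hx
    · exact (hloc _ ⟨by norm_num, le_rfl⟩).1
  · rcases le_or_gt x 0 with hx0 | hx0
    · rw [hflat.2 k x hx0, abs_zero]; positivity
    · refine ((hloc x ⟨hx0, hx⟩).2 k 0).trans ?_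
      -- The choice of `κ` enters here: `k!` from Cauchy times `(k!)^{1/κ} = (k!)^{s-1}` is
      -- `(k!)^s`.
      rw [pow_zero, one_mul, add_zero, hκs]
      have hf : (0 : ℝ) < k.factorial := by positivity
      calc (k.factorial : ℝ) * B / r ^ k * (m ^ k * (k.factorial : ℝ) ^ (s - 1))
          = B * (m / r) ^ k * (k.factorial : ℝ) ^ s := by
            rw [Real.rpow_sub_one hf.ne', div_pow]; field_simp
        _ ≤ _ := by gcongr; exact le_max_right _ _

/-- `φ_s` is smooth and Gevrey of order `s`. -/
theorem step_gevrey {s : ℝ} (hs : 1 < s) :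
    ∃ A M : ℝ, 0 < A ∧ 1 ≤ M ∧ ContDiff ℝ (⊤ : ℕ∞) (step s) ∧
      ∀ x k, |iteratedDeriv k (step s) x| ≤ A * M ^ k * (k.factorial : ℝ) ^ s := by
  obtain ⟨A, M, hA, hM, h⟩ := one_sub_step_gevrey hs
  have e1 : step s = fun x => 1 - (1 - step s x) := by ext; ring
  have e2 : step s = fun x => (fun y => 1 - step s y) (1 - x) := by
    ext x; simp only [step_one_sub]; ring
  -- The extra `1` absorbs the constant in `φ_s = 1 - (1 - φ_s)`.
  refine ⟨A + 1, M, by positivity, hM, ?_, fun x k => ?_⟩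
  · rw [contDiff_iff_contDiffAt]
    intro x
    rcases le_or_gt x (1 / 2) with hx | hx
    · rw [e1]; exact contDiffAt_const.sub (h x hx).1
    · rw [e2]
      exact ContDiffAt.comp (g := fun y => 1 - step s y) (f := fun x => 1 - x) x
        (h (1 - x) (by linarith)).1 (contDiffAt_const.sub contDiffAt_id)
  · have hf1 : (1 : ℝ) ≤ (k.factorial : ℝ) ^ s :=
      Real.one_le_rpow (by exact_mod_cast k.factorial_pos) (by linarith)
    have hMk : 1 ≤ M ^ k := one_le_pow₀ hM
    rcases le_or_gt x (1 / 2) with hx | hx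
    · rw [e1, iteratedDeriv_fun_sub contDiffAt_const ((h x hx).1.of_le (by exact_mod_cast le_top)),
        iteratedDeriv_const]
      have := (h x hx).2 k
      have h1 : |if k = 0 then (1 : ℝ) else 0| ≤ 1 := by split_ifs <;> simp
      refine (abs_sub _ _).trans ?_
      nlinarith [mul_le_mul hMk hf1 zero_le_one (by positivity)]
    · rw [e2, congrFun (iteratedDeriv_comp_const_sub k (fun y => 1 - step s y) 1) x]
      simp only [smul_eq_mul, abs_mul, abs_pow, abs_neg, abs_one, one_pow, one_mul]
      refine ((h (1 - x) (by linarith)).2 k).trans ?_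
      gcongr
      linarith

/-! ### Localized power series -/

/-- The power series with Taylor coefficients `d` at `τ`, cut off by the step function. -/
noncomputable def cutoffSeries (s τ R' : ℝ) (d : ℕ → ℝ) (t : ℝ) : ℝ :=
  step s ((t - τ) / R') * ∑' k : ℕ, d k * (t - τ) ^ k / (k.factorial : ℝ)

theorem norm_taylor_term_le {d : ℕ → ℝ} {A ρ x : ℝ} (hρ : 0 < ρ)
    (hd : ∀ k, |d k| ≤ A * (k.factorial / ρ ^ k)) (k : ℕ) (hx : 0 ≤ x) :
    |d k| * x ^ k / (k.factorial : ℝ) ≤ A * (x / ρ) ^ k := by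
  have hf : (0 : ℝ) < k.factorial := by positivity
  rw [div_le_iff₀ hf]
  calc |d k| * x ^ k ≤ A * (k.factorial / ρ ^ k) * x ^ k := by gcongr; exact hd k
    _ = _ := by rw [div_pow]; field_simp

theorem summable_taylor {d : ℕ → ℝ} {A ρ x : ℝ} (hρ : 0 < ρ)
    (hd : ∀ k, |d k| ≤ A * (k.factorial / ρ ^ k)) (hx : |x| < ρ) :
    Summable fun k : ℕ => d k * x ^ k / (k.factorial : ℝ) := by
  refine Summable.of_norm_bounded (g := fun k => A * (|x| / ρ) ^ k)
    ((summable_geometric_of_lt_one (by positivity) ((div_lt_one hρ).2 hx)).mul_left A)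
    fun k => ?_
  rw [norm_div, norm_mul, norm_pow, Real.norm_natCast]
  exact norm_taylor_term_le hρ hd k (abs_nonneg x)

/-- Discs of radius `δ/2` about points of `[τ, τ+R']` stay inside a disc of radius `σ < ρ` about
`τ`, where a geometric series dominates, so Cauchy's estimates are uniform. The constants do not
depend on the coefficients. -/
theorem taylor_derivative_bound {R' ρ : ℝ} (hR' : 0 < R') (hρ : R' < ρ) :
    ∃ A₀ M : ℝ, 0 < A₀ ∧ 1 ≤ M ∧ ∀ (τ A : ℝ) (d : ℕ → ℝ), 0 ≤ A →
      (∀ k, |d k| ≤ A * (k.factorial / ρ ^ k)) → ∀ t ∈ Icc τ (τ + R'),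
        ContDiffAt ℝ (⊤ : ℕ∞) (fun t => ∑' k : ℕ, d k * (t - τ) ^ k / (k.factorial : ℝ)) t ∧
        ∀ i, |iteratedDeriv i (fun t => ∑' k : ℕ, d k * (t - τ) ^ k / (k.factorial : ℝ)) t| ≤
          A * (A₀ * M ^ i * i.factorial) := by
  have hρ0 : 0 < ρ := hR'.trans hρ
  set δ : ℝ := (ρ - R') / 2 with hδ
  have hδ0 : 0 < δ := by rw [hδ]; linarith
  set σ : ℝ := R' + δ with hσ
  have hσ0 : 0 < σ := by positivity
  have hσρ : σ < ρ := by rw [hσ, hδ]; linarith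
  have hq : σ / ρ < 1 := (div_lt_one hρ0).2 hσρ
  have hq0 : 0 ≤ σ / ρ := by positivity
  refine ⟨(1 - σ / ρ)⁻¹, max 1 (δ / 2)⁻¹, inv_pos.2 (by linarith), le_max_left _ _, ?_⟩
  intro τ A d hA hd t ht
  set F : ℂ → ℂ := fun z => ∑' k : ℕ, ((d k / k.factorial : ℝ) : ℂ) * (z - τ) ^ k with hF
  have hterm : ∀ (k : ℕ), ∀ z ∈ Metric.ball (τ : ℂ) σ,
      ‖((d k / k.factorial : ℝ) : ℂ) * (z - τ) ^ k‖ ≤ A * (σ / ρ) ^ k := by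
    intro k z hz
    have hz' : ‖z - τ‖ ≤ σ := (mem_ball_iff_norm.1 hz).le
    rw [norm_mul, norm_pow, Complex.norm_real, norm_div, Real.norm_natCast, Real.norm_eq_abs]
    calc |d k| / k.factorial * ‖z - τ‖ ^ k = |d k| * ‖z - τ‖ ^ k / k.factorial := by ring
      _ ≤ A * (‖z - τ‖ / ρ) ^ k := norm_taylor_term_le hρ0 hd k (norm_nonneg _)
      _ ≤ _ := by gcongr
  have hsum : Summable fun k : ℕ => A * (σ / ρ) ^ k :=
    (summable_geometric_of_lt_one hq0 hq).mul_left A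
  have hdiff : DifferentiableOn ℂ F (Metric.ball (τ : ℂ) σ) :=
    Complex.differentiableOn_tsum_of_summable_norm hsum (fun k => by fun_prop)
      Metric.isOpen_ball hterm
  have key := abs_iteratedDeriv_re_le (F := F) (x := t) (r := δ / 2) (B := A * (1 - σ / ρ)⁻¹)
    (f := fun t => ∑' k : ℕ, d k * (t - τ) ^ k / (k.factorial : ℝ)) (by positivity) ?_ ?_
  · refine ⟨key.1, fun i => (key.2 i).trans ?_⟩
    have h1 : 0 < 1 - σ / ρ := by linarith
    calc (i.factorial : ℝ) * (A * (1 - σ / ρ)⁻¹) / (δ / 2) ^ i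
        = A * ((1 - σ / ρ)⁻¹ * ((δ / 2)⁻¹) ^ i * i.factorial) := by rw [inv_pow]; field_simp
      _ ≤ _ := by gcongr; exact le_max_right _ _
  · intro z hz
    have hzb : z ∈ Metric.ball (τ : ℂ) σ := by
      have h1 : ‖(t : ℂ) - τ‖ ≤ R' := by
        rw [← Complex.ofReal_sub, Complex.norm_real, Real.norm_eq_abs, abs_of_nonneg]
        · linarith [ht.2]
        · linarith [ht.1]
      have h2 : ‖z - τ‖ ≤ ‖z - t‖ + ‖(t : ℂ) - τ‖ := norm_sub_le_norm_sub_add_norm_sub z t τ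
      rw [Metric.mem_ball, dist_eq_norm]
      linarith
    refine ⟨hdiff.differentiableAt (Metric.isOpen_ball.mem_nhds hzb), ?_⟩
    refine tsum_of_norm_bounded ?_ fun k => hterm k z hzb
    exact (hasSum_geometric_of_lt_one hq0 hq).mul_left A
  · refine Eventually.of_forall fun x => ?_
    have : F x = ((∑' k : ℕ, d k * (x - τ) ^ k / (k.factorial : ℝ) : ℝ) : ℂ) := by
      rw [hF, Complex.ofReal_tsum]
      refine tsum_congr fun k => ?_
      push_cast
      ring
    rw [this, Complex.ofReal_re]

/-- Leibniz' rule: since `s ≥ 1`, `(j!)^s (i-j)! ≤ (j! (i-j)!)^s ≤ (i!)^s`, and the remaining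
binomial sum is `(M + N)^i`. -/
theorem abs_iteratedDeriv_mul_le {f g : ℝ → ℝ} {t s A B M N : ℝ} {i : ℕ} (hs : 1 ≤ s) (hA : 0 ≤ A)
    (hB : 0 ≤ B) (hM : 0 ≤ M) (hN : 0 ≤ N)
    (hf : ContDiffAt ℝ (⊤ : ℕ∞) f t) (hg : ContDiffAt ℝ (⊤ : ℕ∞) g t)
    (hfb : ∀ k, |iteratedDeriv k f t| ≤ A * M ^ k * (k.factorial : ℝ) ^ s)
    (hgb : ∀ k, |iteratedDeriv k g t| ≤ B * N ^ k * k.factorial) :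
    |iteratedDeriv i (fun t => f t * g t) t| ≤ A * B * (M + N) ^ i * (i.factorial : ℝ) ^ s := by
  rw [iteratedDeriv_fun_mul (hf.of_le (by exact_mod_cast le_top))
    (hg.of_le (by exact_mod_cast le_top))]
  refine (Finset.abs_sum_le_sum_abs _ _).trans ?_
  rw [add_pow, Finset.mul_sum, Finset.sum_mul]
  refine Finset.sum_le_sum fun j hj => ?_
  have hji : j ≤ i := Nat.lt_succ_iff.1 (Finset.mem_range.1 hj)
  have h1 : (1 : ℝ) ≤ (i - j).factorial := by exact_mod_cast Nat.factorial_pos _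
  have h2 : (j.factorial : ℝ) ^ s * (i - j).factorial ≤ (i.factorial : ℝ) ^ s := by
    calc (j.factorial : ℝ) ^ s * (i - j).factorial
        ≤ (j.factorial : ℝ) ^ s * ((i - j).factorial : ℝ) ^ s := by
          gcongr
          exact Real.self_le_rpow_of_one_le h1 hs
      _ = ((j.factorial : ℝ) * (i - j).factorial) ^ s := by
          rw [Real.mul_rpow (by positivity) (by positivity)]
      _ ≤ _ := by
          gcongr
          have := Nat.factorial_mul_factorial_dvd_factorial hji
          exact_mod_cast Nat.le_of_dvd (Nat.factorial_pos i) this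
  rw [abs_mul, abs_mul, Nat.abs_cast]
  calc (i.choose j : ℝ) * |iteratedDeriv j f t| * |iteratedDeriv (i - j) g t|
      ≤ (i.choose j : ℝ) * (A * M ^ j * (j.factorial : ℝ) ^ s) *
        (B * N ^ (i - j) * (i - j).factorial) := by
        gcongr
        · exact hfb j
        · exact hgb (i - j)
    _ = A * B * (M ^ j * N ^ (i - j) * i.choose j) *
        ((j.factorial : ℝ) ^ s * (i - j).factorial) := by ring
    _ ≤ _ := by gcongr

/-- Linearity in `A` lets one bound serve both the exact output and the truncation error. Beyond `τ
+ R'` the power series may diverge, but the step vanishes there. -/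
theorem cutoffSeries_gevrey {s R' ρ : ℝ} (hs : 1 < s) (hR' : 0 < R') (hρ : R' < ρ) :
    ∃ C₀ M : ℝ, 0 < C₀ ∧ 1 ≤ M ∧ ∀ (τ A : ℝ) (d : ℕ → ℝ), 0 ≤ A →
      (∀ k, |d k| ≤ A * (k.factorial / ρ ^ k)) → ∀ t, τ ≤ t →
        ContDiffAt ℝ (⊤ : ℕ∞) (cutoffSeries s τ R' d) t ∧
        ∀ i, |iteratedDeriv i (cutoffSeries s τ R' d) t| ≤
          A * (C₀ * M ^ i * (i.factorial : ℝ) ^ s) := by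
  obtain ⟨A₁, M₁, hA₁, hM₁, hsm, hstep⟩ := step_gevrey hs
  obtain ⟨A₂, M₂, hA₂, hM₂, hser⟩ := taylor_derivative_bound hR' hρ
  refine ⟨A₁ * A₂, R'⁻¹ * M₁ + M₂, by positivity, by
    have : 0 < R'⁻¹ * M₁ := by positivity
    linarith, fun τ A d hA hd t ht => ?_⟩
  rcases le_or_gt t (τ + R') with ht' | ht'
  · obtain ⟨hc, hb⟩ := hser τ A d hA hd t ⟨ht, ht'⟩
    have e : (fun t => step s ((t - τ) / R')) = fun t => (fun x => step s (R'⁻¹ * x)) (t - τ) := by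
      ext t; simp only [div_eq_inv_mul]
    have hc1 : ContDiffAt ℝ (⊤ : ℕ∞) (fun t => step s ((t - τ) / R')) t :=
      (hsm.comp ((contDiff_id.sub contDiff_const).div_const R')).contDiffAt
    refine ⟨hc1.mul hc, fun i => ?_⟩
    refine (abs_iteratedDeriv_mul_le (A := A₁) (B := A * A₂) (M := R'⁻¹ * M₁) (N := M₂) hs.le
      hA₁.le (by positivity) (by positivity) (by positivity) hc1 hc (fun k => ?_)
      (fun k => (hb k).trans_eq (by ring))).trans_eq (by ring)
    rw [e, congrFun (iteratedDeriv_comp_sub_const k (fun x => step s (R'⁻¹ * x)) τ) t,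
      congrFun (iteratedDeriv_comp_const_mul (hsm.of_le (by exact_mod_cast le_top)) R'⁻¹) (t - τ),
      abs_mul, abs_of_pos (by positivity : 0 < R'⁻¹ ^ k), mul_pow]
    calc R'⁻¹ ^ k * |iteratedDeriv k (step s) (R'⁻¹ * (t - τ))|
        ≤ R'⁻¹ ^ k * (A₁ * M₁ ^ k * (k.factorial : ℝ) ^ s) := by gcongr; exact hstep _ k
      _ = _ := by ring
  · have h0 : cutoffSeries s τ R' d =ᶠ[𝓝 t] fun _ => 0 := by
      filter_upwards [Ioi_mem_nhds ht'] with x hx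
      rw [cutoffSeries, step_of_one_le, zero_mul]
      rw [one_le_div hR']
      linarith [mem_Ioi.1 hx]
    refine ⟨contDiffAt_const.congr_of_eventuallyEq h0, fun i => ?_⟩
    rw [Filter.EventuallyEq.iteratedDeriv_eq i h0, iteratedDeriv_const]
    simp only [ite_self, abs_zero]
    positivity

/-- Away from the left end of the disc of convergence, `cutoffSeries` is additive. -/
theorem cutoffSeries_sub {s τ R' ρ A B t : ℝ} {d e : ℕ → ℝ} (hR' : 0 < R') (hρ : R' < ρ)
    (hd : ∀ k, |d k| ≤ A * (k.factorial / ρ ^ k)) (he : ∀ k, |e k| ≤ B * (k.factorial / ρ ^ k))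
    (ht : τ - ρ < t) :
    cutoffSeries s τ R' (fun k => d k - e k) t =
      cutoffSeries s τ R' d t - cutoffSeries s τ R' e t := by
  unfold cutoffSeries
  rcases le_or_gt t (τ + R') with ht' | ht'
  · have hx : |t - τ| < ρ := abs_lt.2 ⟨by linarith, by linarith⟩
    rw [← mul_sub, ← (summable_taylor (hR'.trans hρ) hd hx).tsum_sub
      (summable_taylor (hR'.trans hρ) he hx)]
    congr 1
    exact tsum_congr fun k => by ring
  · rw [step_of_one_le (by rw [one_le_div hR']; linarith)]
    simp

/-! ### Decay of the output coefficients -/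

/-- The factor `e^{-xρ}` pays for `x^k`; the rest of the exponential is kept as decay. -/
theorem pow_mul_exp_neg_le {x τ ρ : ℝ} (hx : 0 ≤ x) (hρ : 0 < ρ) (k : ℕ) :
    x ^ k * Real.exp (-(x * τ)) ≤ k.factorial / ρ ^ k * Real.exp (-(x * (τ - ρ))) := by
  have h := Real.pow_div_factorial_le_exp (x * ρ) (by positivity) k
  have hf : (0 : ℝ) < k.factorial := by positivity
  rw [div_le_iff₀ hf, mul_pow] at h
  rw [show -(x * (τ - ρ)) = x * ρ + -(x * τ) by ring, Real.exp_add, ← mul_assoc]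
  gcongr
  rw [div_mul_eq_mul_div, le_div_iff₀ (by positivity)]
  linarith

/-- The weights `e^{-c n²}`. -/
noncomputable def gaussWeight (c : ℝ) (n : ℕ) : ℝ := Real.exp (-c * (n : ℝ) ^ 2)

theorem summable_gaussWeight {c : ℝ} (hc : 0 < c) : Summable (gaussWeight c) := by
  refine Summable.of_nonneg_of_le (fun n => (Real.exp_pos _).le) (fun n => ?_)
    (summable_geometric_of_lt_one (Real.exp_pos (-c)).le (Real.exp_lt_one_iff.2 (by linarith)))
  rw [← Real.exp_nat_mul, gaussWeight]
  apply Real.exp_le_exp.2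
  have : (n : ℝ) ≤ (n : ℝ) ^ 2 := by exact_mod_cast Nat.le_self_pow two_ne_zero n
  nlinarith

theorem gaussWeight_anti {c : ℝ} (hc : 0 < c) {m n : ℕ} (h : m ≤ n) :
    gaussWeight c n ≤ gaussWeight c m := by
  apply Real.exp_le_exp.2
  have : (m : ℝ) ^ 2 ≤ (n : ℝ) ^ 2 := by gcongr
  nlinarith

/-- The Gaussian is written as a square so that one factor can measure the tail beyond `N` while the
other is summed over `n`. -/
theorem abs_outputCoeffTerm_le {τ ρ a : ℝ} {θ₀ : L2} (hρ : 0 < ρ)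
    (ha : ∀ n, |cosCoeff θ₀ n| ≤ a) (k n : ℕ) :
    |outputCoeffTerm τ θ₀ k n| * (Real.pi ^ 2) ^ k ≤
      a * (k.factorial / ρ ^ k) * (gaussWeight (Real.pi ^ 2 * (τ - ρ) / 2) n) ^ 2 := by
  have ha0 : 0 ≤ a := (abs_nonneg _).trans (ha 0)
  have h := pow_mul_exp_neg_le (τ := τ) (by positivity : 0 ≤ (n : ℝ) ^ 2 * Real.pi ^ 2) hρ k
  have e : (gaussWeight (Real.pi ^ 2 * (τ - ρ) / 2) n) ^ 2 =
      Real.exp (-((n : ℝ) ^ 2 * Real.pi ^ 2 * (τ - ρ))) := by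
    rw [gaussWeight, ← Real.exp_nat_mul]; congr 1; push_cast; ring
  rw [outputCoeffTerm, abs_mul, abs_mul, Real.abs_exp, abs_pow, Nat.abs_cast, e]
  calc |cosCoeff θ₀ n| * Real.exp (-(n : ℝ) ^ 2 * Real.pi ^ 2 * τ) * (n : ℝ) ^ (2 * k) *
        (Real.pi ^ 2) ^ k
      = |cosCoeff θ₀ n| * (((n : ℝ) ^ 2 * Real.pi ^ 2) ^ k *
          Real.exp (-((n : ℝ) ^ 2 * Real.pi ^ 2 * τ))) := by
        rw [pow_mul, mul_pow, ← neg_mul, ← neg_mul]; ring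
    _ ≤ a * (k.factorial / ρ ^ k * Real.exp (-((n : ℝ) ^ 2 * Real.pi ^ 2 * (τ - ρ)))) := by
        gcongr
        exact ha n
    _ = _ := by ring

theorem abs_outputCoeffTerm_le_of_le {τ ρ a : ℝ} {θ₀ : L2} (hρ : 0 < ρ) (hρτ : ρ < τ)
    (ha : ∀ n, |cosCoeff θ₀ n| ≤ a) (k : ℕ) {N n : ℕ} (hn : N ≤ n) :
    |outputCoeffTerm τ θ₀ k n| * (Real.pi ^ 2) ^ k ≤
      a * (k.factorial / ρ ^ k) * gaussWeight (Real.pi ^ 2 * (τ - ρ) / 2) N *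
        gaussWeight (Real.pi ^ 2 * (τ - ρ) / 2) n := by
  have hc : 0 < Real.pi ^ 2 * (τ - ρ) / 2 := by
    have := Real.pi_pos; have : 0 < τ - ρ := by linarith
    positivity
  have ha0 : 0 ≤ a := (abs_nonneg _).trans (ha 0)
  refine (abs_outputCoeffTerm_le hρ ha k n).trans ?_
  rw [sq, ← mul_assoc]
  have : 0 ≤ gaussWeight (Real.pi ^ 2 * (τ - ρ) / 2) n := (Real.exp_pos _).le
  gcongr
  exact gaussWeight_anti hc hn

theorem summable_outputCoeffTerm {τ a : ℝ} {θ₀ : L2} (hτ : 0 < τ)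
    (ha : ∀ n, |cosCoeff θ₀ n| ≤ a) (k : ℕ) : Summable (outputCoeffTerm τ θ₀ k) := by
  have hc : 0 < Real.pi ^ 2 * (τ - τ / 2) / 2 := by
    have := Real.pi_pos; have : 0 < τ - τ / 2 := by linarith
    positivity
  have hp : 0 < (Real.pi ^ 2) ^ k := by have := Real.pi_pos; positivity
  refine Summable.of_norm_bounded (g := fun n => (a * (k.factorial / (τ / 2) ^ k) *
    gaussWeight (Real.pi ^ 2 * (τ - τ / 2) / 2) 0 / (Real.pi ^ 2) ^ k) *
      gaussWeight (Real.pi ^ 2 * (τ - τ / 2) / 2) n) ((summable_gaussWeight hc).mul_left _)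
    fun n => ?_
  rw [Real.norm_eq_abs, div_mul_eq_mul_div, le_div_iff₀ hp]
  exact abs_outputCoeffTerm_le_of_le (by positivity) (by linarith) ha k n.zero_le

/-- Used with `N = 0` for `y_k` itself and with `N + 1` for the error of its truncation. -/
theorem abs_modeSum_le {τ ρ a : ℝ} {θ₀ : L2} (hρ : 0 < ρ) (hρτ : ρ < τ)
    (ha : ∀ n, |cosCoeff θ₀ n| ≤ a) (k N : ℕ) :
    |√2 * (∑' n : ℕ, outputCoeffTerm τ θ₀ k (n + N)) * (-Real.pi ^ 2) ^ k| ≤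
      √2 * (∑' n, gaussWeight (Real.pi ^ 2 * (τ - ρ) / 2) n) * a *
        gaussWeight (Real.pi ^ 2 * (τ - ρ) / 2) N * (k.factorial / ρ ^ k) := by
  have ha0 : 0 ≤ a := (abs_nonneg _).trans (ha 0)
  set c := Real.pi ^ 2 * (τ - ρ) / 2 with hcdef
  have hc : 0 < c := by
    have := Real.pi_pos; have : 0 < τ - ρ := by linarith
    positivity
  have hpos : ∀ n, 0 ≤ gaussWeight c n := fun n => (Real.exp_pos _).le
  have hsum := summable_gaussWeight hc
  have hsh : Summable fun n => gaussWeight c (n + N) := (summable_nat_add_iff N).2 hsum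
  have hle : ∑' n, gaussWeight c (n + N) ≤ ∑' n, gaussWeight c n := by
    rw [← hsum.sum_add_tsum_nat_add N]
    have : 0 ≤ ∑ n ∈ Finset.range N, gaussWeight c n := Finset.sum_nonneg fun n _ => hpos n
    linarith
  have hp : 0 < (Real.pi ^ 2) ^ k := by have := Real.pi_pos; positivity
  have key : |∑' n : ℕ, outputCoeffTerm τ θ₀ k (n + N)| ≤
      (a * (k.factorial / ρ ^ k) * gaussWeight c N / (Real.pi ^ 2) ^ k) *
        ∑' n, gaussWeight c (n + N) := by
    refine tsum_of_norm_bounded (f := fun n => outputCoeffTerm τ θ₀ k (n + N))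
      (hsh.hasSum.mul_left _) fun n => ?_
    rw [Real.norm_eq_abs, div_mul_eq_mul_div, le_div_iff₀ hp]
    exact abs_outputCoeffTerm_le_of_le hρ hρτ ha k (Nat.le_add_left N n)
  rw [abs_mul, abs_mul, abs_pow, abs_neg, abs_of_nonneg (Real.sqrt_nonneg 2),
    abs_of_nonneg (by positivity : 0 ≤ Real.pi ^ 2)]
  have hN := hpos N
  calc √2 * |∑' n : ℕ, outputCoeffTerm τ θ₀ k (n + N)| * (Real.pi ^ 2) ^ k
      ≤ √2 * ((a * (k.factorial / ρ ^ k) * gaussWeight c N / (Real.pi ^ 2) ^ k) *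
        ∑' n, gaussWeight c n) * (Real.pi ^ 2) ^ k := by
        gcongr
        exact key.trans (by gcongr)
    _ = _ := by field_simp

theorem abs_outputCoeff_le {τ ρ a : ℝ} {θ₀ : L2} (hρ : 0 < ρ) (hρτ : ρ < τ)
    (ha : ∀ n, |cosCoeff θ₀ n| ≤ a) (k : ℕ) :
    |outputCoeff τ θ₀ k| ≤
      √2 * (∑' n, gaussWeight (Real.pi ^ 2 * (τ - ρ) / 2) n) * a * (k.factorial / ρ ^ k) := by
  have h := abs_modeSum_le hρ hρτ ha k 0
  rwa [show gaussWeight (Real.pi ^ 2 * (τ - ρ) / 2) 0 = 1 by simp [gaussWeight], mul_one] at h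

theorem abs_outputCoeff_sub_trunc_le {τ ρ a : ℝ} {θ₀ : L2} (hρ : 0 < ρ) (hρτ : ρ < τ)
    (ha : ∀ n, |cosCoeff θ₀ n| ≤ a) (k N : ℕ) :
    |outputCoeff τ θ₀ k - truncOutputCoeff τ θ₀ N k| ≤
      √2 * (∑' n, gaussWeight (Real.pi ^ 2 * (τ - ρ) / 2) n) * a *
        gaussWeight (Real.pi ^ 2 * (τ - ρ) / 2) N * (k.factorial / ρ ^ k) := by
  have ha0 : 0 ≤ a := (abs_nonneg _).trans (ha 0)
  have hc : 0 < Real.pi ^ 2 * (τ - ρ) / 2 := by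
    have := Real.pi_pos; have : 0 < τ - ρ := by linarith
    positivity
  have hS : 0 ≤ ∑' n, gaussWeight (Real.pi ^ 2 * (τ - ρ) / 2) n :=
    tsum_nonneg fun n => (Real.exp_pos _).le
  have e : outputCoeff τ θ₀ k - truncOutputCoeff τ θ₀ N k =
      √2 * (∑' n : ℕ, outputCoeffTerm τ θ₀ k (n + (N + 1))) * (-Real.pi ^ 2) ^ k := by
    rw [outputCoeff, truncOutputCoeff,
      ← (summable_outputCoeffTerm (hρ.trans hρτ) ha k).sum_add_tsum_nat_add (N + 1)]
    ring
  rw [e]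
  refine (abs_modeSum_le hρ hρτ ha k (N + 1)).trans ?_
  gcongr
  exact gaussWeight_anti hc N.le_succ

/-! ### Factorial estimates for the control series -/

/-- Pair the factors of the two factorials in opposite order: `(j+1)(n-j) ≥ n` for `j < n`. -/
theorem pow_self_le_factorial_sq (n : ℕ) : n ^ n ≤ n.factorial ^ 2 := by
  have h : n.factorial ^ 2 = ∏ j ∈ Finset.range n, (j + 1) * (n - 1 - j + 1) := by
    rw [Finset.prod_mul_distrib, Finset.prod_range_add_one_eq_factorial,
      Finset.prod_range_reflect (fun j => j + 1) n, Finset.prod_range_add_one_eq_factorial, sq]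
  rw [h]
  calc n ^ n = ∏ _j ∈ Finset.range n, n := by simp
    _ ≤ _ := by
      refine Finset.prod_le_prod' fun j hj => ?_
      have hj := Finset.mem_range.1 hj
      obtain ⟨m, rfl⟩ : ∃ m, n = j + 1 + m := ⟨n - (j + 1), by omega⟩
      rw [show j + 1 + m - 1 - j + 1 = m + 1 by omega]
      nlinarith

theorem inv_factorial_rpow_le {ε : ℝ} (hε : 0 ≤ ε) (I : ℕ) :
    ((I.factorial : ℝ) ^ ε)⁻¹ ≤ Real.exp (-(ε / 2) * ((I : ℝ) * Real.log I)) := by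
  -- At `I = 0` both sides equal `1`, in accordance with `0 ln 0 = 0`.
  rcases Nat.eq_zero_or_pos I with rfl | hI
  · simp
  have hI' : (0 : ℝ) < I := by exact_mod_cast hI
  rw [neg_mul, Real.exp_neg]
  refine inv_anti₀ (Real.exp_pos _) ?_
  rw [Real.rpow_def_of_pos (by positivity)]
  apply Real.exp_le_exp.2
  have h : (I : ℝ) * Real.log I ≤ 2 * Real.log I.factorial := by
    have := Real.log_le_log (by positivity)
      (by exact_mod_cast pow_self_le_factorial_sq I : (I : ℝ) ^ I ≤ (I.factorial : ℝ) ^ 2)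
    rw [Real.log_pow, Real.log_pow] at this
    exact_mod_cast this
  nlinarith

theorem summable_pow_div_factorial_rpow {L ε : ℝ} (hL : 0 < L) (hε : 0 < ε) :
    Summable fun i : ℕ => L ^ i / (i.factorial : ℝ) ^ ε := by
  -- Chosen so that the `i`-th term is `(Λ^i / i!)^ε`, which is bounded by `(e^Λ)^ε`, times the
  -- geometric factor `2^{-εi}`.
  set Λ : ℝ := 2 * L ^ ε⁻¹ with hΛ
  have hΛ0 : 0 < Λ := by positivity
  have hq : ((2 : ℝ)⁻¹) ^ ε < 1 := Real.rpow_lt_one (by norm_num) (by norm_num) hε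
  refine Summable.of_nonneg_of_le (fun i => by positivity) (fun i => ?_)
    ((summable_geometric_of_lt_one (by positivity) hq).mul_left (Real.exp Λ ^ ε))
  have h := Real.rpow_le_rpow (by positivity) (Real.pow_div_factorial_le_exp Λ hΛ0.le i) hε.le
  have e : (Λ ^ i / i.factorial) ^ ε * (((2 : ℝ)⁻¹) ^ ε) ^ i = L ^ i / (i.factorial : ℝ) ^ ε := by
    have e1 : L = (L ^ ε⁻¹) ^ ε := by rw [← Real.rpow_mul hL.le, inv_mul_cancel₀ hε.ne',
      Real.rpow_one]
    rw [Real.div_rpow (by positivity) (by positivity), ← Real.rpow_natCast _ i,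
      ← Real.rpow_natCast _ i, ← Real.rpow_mul hΛ0.le, mul_comm (i : ℝ) ε, Real.rpow_mul hΛ0.le,
      div_mul_eq_mul_div, ← Real.mul_rpow (by positivity) (by positivity),
      ← Real.mul_rpow hΛ0.le (by positivity), hΛ]
    conv_rhs => rw [e1]
    rw [show 2 * L ^ ε⁻¹ * 2⁻¹ = L ^ ε⁻¹ by ring, Real.rpow_natCast]
  rw [← e]
  gcongr

/-- Majorant for the `i`-th term of the control series. -/
noncomputable def controlWeight (s M : ℝ) (i : ℕ) : ℝ :=
  (2 * M) ^ (i + 1) / ((i + 1).factorial : ℝ) ^ ((2 - s) / 2)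

theorem summable_controlWeight {s M : ℝ} (hs : s < 2) (hM : 1 ≤ M) :
    Summable (controlWeight s M) := by
  have := summable_pow_div_factorial_rpow (L := 2 * M) (ε := (2 - s) / 2) (by positivity)
    (by linarith)
  exact (summable_nat_add_iff 1).2 this

/-- With `F = (i+1)!`, `F² ≤ 2^(i+1) (2i+1)!` leaves the surplus `F^{-(2-s)}`. Half of it gives the
decay in `I`, through `F ≥ I!`; the other half stays in `controlWeight` for summability. -/
theorem gevrey_term_le_controlWeight {s M : ℝ} (hs : s < 2) (hM : 1 ≤ M) {I i : ℕ} (hi : I ≤ i) :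
    M ^ (i + 1) * ((i + 1).factorial : ℝ) ^ s / ((2 * i + 1).factorial : ℝ) ≤
      Real.exp (-((2 - s) / 4) * ((I : ℝ) * Real.log I)) * controlWeight s M i := by
  set F : ℝ := ((i + 1).factorial : ℝ) with hF
  have hF0 : 0 < F := by positivity
  have h1 : F ^ 2 ≤ 2 ^ (i + 1) * ((2 * i + 1).factorial : ℝ) := by
    have a1 : (i + 1).factorial * i.factorial ≤ (2 * i + 1).factorial := by
      have := Nat.factorial_mul_factorial_dvd_factorial_add (i + 1) i
      rw [show i + 1 + i = 2 * i + 1 by ring] at this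
      exact Nat.le_of_dvd (Nat.factorial_pos _) this
    have a2 : i + 1 ≤ 2 ^ (i + 1) := Nat.lt_two_pow_self.le
    have a3 : (i + 1).factorial ^ 2 ≤ 2 ^ (i + 1) * (2 * i + 1).factorial := by
      calc (i + 1).factorial ^ 2 = (i + 1) * ((i + 1).factorial * i.factorial) := by
            rw [sq]; nth_rewrite 2 [Nat.factorial_succ]; ring
        _ ≤ _ := Nat.mul_le_mul a2 a1
    rw [hF]; exact_mod_cast a3
  have h2 : ((I.factorial : ℝ) ^ ((2 - s) / 2)) ≤ F ^ ((2 - s) / 2) := by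
    apply Real.rpow_le_rpow (by positivity) _ (by linarith)
    rw [hF]; exact_mod_cast Nat.factorial_le (by omega)
  have h3 := inv_factorial_rpow_le (ε := (2 - s) / 2) (by linarith) I
  have h4 : F ^ s = F ^ 2 * ((F ^ ((2 - s) / 2))⁻¹ * (F ^ ((2 - s) / 2))⁻¹) := by
    rw [← Real.rpow_neg hF0.le, ← Real.rpow_add hF0, ← Real.rpow_natCast F 2,
      ← Real.rpow_add hF0]
    congr 1; push_cast; ring
  rw [div_le_iff₀ (by positivity), h4, controlWeight, ← hF]
  have h5 : (F ^ ((2 - s) / 2))⁻¹ ≤ Real.exp (-((2 - s) / 4) * ((I : ℝ) * Real.log I)) := by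
    refine (inv_anti₀ (by positivity) h2).trans (h3.trans_eq ?_)
    congr 1; ring
  calc M ^ (i + 1) * (F ^ 2 * ((F ^ ((2 - s) / 2))⁻¹ * (F ^ ((2 - s) / 2))⁻¹))
      ≤ M ^ (i + 1) * ((2 ^ (i + 1) * ((2 * i + 1).factorial : ℝ)) *
        (Real.exp (-((2 - s) / 4) * ((I : ℝ) * Real.log I)) * (F ^ ((2 - s) / 2))⁻¹)) := by
        gcongr
    _ = _ := by rw [mul_pow]; ring

/-! ### The control series -/

theorem abs_control_term_le {s C₀ M A : ℝ} {y : ℝ → ℝ} {t : ℝ} (hs : s < 2) (hC₀ : 0 ≤ C₀)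
    (hM : 1 ≤ M) (hA : 0 ≤ A)
    (hy : ∀ i, |iteratedDeriv i y t| ≤ A * (C₀ * M ^ i * (i.factorial : ℝ) ^ s))
    {I i : ℕ} (hi : I ≤ i) :
    |iteratedDeriv (i + 1) y t / ((2 * i + 1).factorial : ℝ)| ≤
      A * C₀ * Real.exp (-((2 - s) / 4) * ((I : ℝ) * Real.log I)) * controlWeight s M i := by
  rw [abs_div, Nat.abs_cast]
  calc |iteratedDeriv (i + 1) y t| / ((2 * i + 1).factorial : ℝ)
      ≤ A * (C₀ * M ^ (i + 1) * ((i + 1).factorial : ℝ) ^ s) / ((2 * i + 1).factorial : ℝ) := by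
        gcongr; exact hy (i + 1)
    _ = A * C₀ * (M ^ (i + 1) * ((i + 1).factorial : ℝ) ^ s / ((2 * i + 1).factorial : ℝ)) := by
        ring
    _ ≤ A * C₀ * (Real.exp (-((2 - s) / 4) * ((I : ℝ) * Real.log I)) * controlWeight s M i) := by
        gcongr
        exact gevrey_term_le_controlWeight hs hM hi
    _ = _ := by ring

theorem abs_control_term_le' {s C₀ M A : ℝ} {y : ℝ → ℝ} {t : ℝ} (hs : s < 2) (hC₀ : 0 ≤ C₀)
    (hM : 1 ≤ M) (hA : 0 ≤ A)
    (hy : ∀ i, |iteratedDeriv i y t| ≤ A * (C₀ * M ^ i * (i.factorial : ℝ) ^ s)) (i : ℕ) :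
    |iteratedDeriv (i + 1) y t / ((2 * i + 1).factorial : ℝ)| ≤
      A * C₀ * controlWeight s M i := by
  simpa using abs_control_term_le hs hC₀ hM hA hy i.zero_le

/-- Below `I` the two series are compared term by term, at cost `E`; from `I` on, the tail of the
exact series is the error. -/
theorem abs_controlSeries_sub_le {s C₀ M A E : ℝ} {y z : ℝ → ℝ} {t : ℝ} (hs : s < 2)
    (hC₀ : 0 ≤ C₀) (hM : 1 ≤ M) (hA : 0 ≤ A) (hE : 0 ≤ E)
    (hy : ∀ i, |iteratedDeriv i y t| ≤ A * (C₀ * M ^ i * (i.factorial : ℝ) ^ s))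
    (hyz : ∀ i, |iteratedDeriv i y t - iteratedDeriv i z t| ≤
      E * (C₀ * M ^ i * (i.factorial : ℝ) ^ s)) (I : ℕ) :
    |(∑' i : ℕ, iteratedDeriv (i + 1) y t / ((2 * i + 1).factorial : ℝ)) -
        ∑ i ∈ Finset.range I, iteratedDeriv (i + 1) z t / ((2 * i + 1).factorial : ℝ)| ≤
      (A * Real.exp (-((2 - s) / 4) * ((I : ℝ) * Real.log I)) + E) *
        (C₀ * ∑' i, controlWeight s M i) := by
  have hw : ∀ i, 0 ≤ controlWeight s M i := fun i => by unfold controlWeight; positivity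
  have hws := summable_controlWeight hs hM
  have hsum : Summable fun i : ℕ => iteratedDeriv (i + 1) y t / ((2 * i + 1).factorial : ℝ) :=
    Summable.of_norm_bounded (hws.mul_left (A * C₀)) fun i =>
      abs_control_term_le' hs hC₀ hM hA hy i
  rw [← hsum.sum_add_tsum_nat_add I, add_sub_right_comm, ← Finset.sum_sub_distrib]
  have hsplit := hws.sum_add_tsum_nat_add I
  have h1 : |∑ i ∈ Finset.range I, (iteratedDeriv (i + 1) y t / ((2 * i + 1).factorial : ℝ) -
      iteratedDeriv (i + 1) z t / ((2 * i + 1).factorial : ℝ))| ≤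
      E * C₀ * ∑' i, controlWeight s M i := by
    refine (Finset.abs_sum_le_sum_abs _ _).trans ?_
    calc _ ≤ ∑ i ∈ Finset.range I, E * C₀ * controlWeight s M i := by
          refine Finset.sum_le_sum fun i _ => ?_
          rw [← sub_div, abs_div, Nat.abs_cast]
          have h0 := gevrey_term_le_controlWeight hs hM i.zero_le
          simp only [Nat.cast_zero, zero_mul, mul_zero, Real.exp_zero, one_mul] at h0
          calc _ ≤ E * (C₀ * M ^ (i + 1) * ((i + 1).factorial : ℝ) ^ s) /
                ((2 * i + 1).factorial : ℝ) := by gcongr; exact hyz (i + 1)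
            _ = E * C₀ * (M ^ (i + 1) * ((i + 1).factorial : ℝ) ^ s /
                ((2 * i + 1).factorial : ℝ)) := by ring
            _ ≤ _ := by gcongr
      _ ≤ _ := by
          rw [← Finset.mul_sum]
          gcongr
          exact hws.sum_le_tsum _ fun i _ => hw i
  have h2 : |∑' i : ℕ, iteratedDeriv (i + I + 1) y t / ((2 * (i + I) + 1).factorial : ℝ)| ≤
      A * C₀ * Real.exp (-((2 - s) / 4) * ((I : ℝ) * Real.log I)) *
        ∑' i, controlWeight s M (i + I) :=
    tsum_of_norm_bounded
      (f := fun i : ℕ => iteratedDeriv (i + I + 1) y t / ((2 * (i + I) + 1).factorial : ℝ))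
      (((summable_nat_add_iff I).2 hws).hasSum.mul_left _)
      fun i => abs_control_term_le hs hC₀ hM hA hy (Nat.le_add_left I i)
  have h3 : ∑' i, controlWeight s M (i + I) ≤ ∑' i, controlWeight s M i := by
    rw [← hsplit]
    linarith [Finset.sum_nonneg fun i (_ : i ∈ Finset.range I) => hw i]
  refine (abs_add_le _ _).trans ((add_le_add h1 (h2.trans
    (mul_le_mul_of_nonneg_left h3 (by positivity)))).trans_eq ?_)
  ring

/-- The Taylor coefficients of the truncated flat output. -/
noncomputable def truncSeq (τ : ℝ) (θ₀ : L2) (K N k : ℕ) : ℝ :=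
  if k ≤ K then truncOutputCoeff τ θ₀ N k else 0

theorem truncFlatOutput_eq (s τ R' : ℝ) (θ₀ : L2) (K N : ℕ) :
    truncFlatOutput s τ R' θ₀ K N = cutoffSeries s τ R' (truncSeq τ θ₀ K N) := by
  ext t
  rw [truncFlatOutput, cutoffSeries, tsum_eq_sum (s := Finset.range (K + 1))]
  · congr 1
    refine Finset.sum_congr rfl fun k hk => ?_
    rw [truncSeq, if_pos (Nat.lt_succ_iff.1 (Finset.mem_range.1 hk))]
  · intro k hk
    rw [truncSeq, if_neg (by simpa [Nat.lt_succ_iff] using hk)]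
    simp

/-- For `k ≤ K` only the mode tail is lost. For `k > K` all of `y_k` is, and passing from radius `ρ`
to `ρ'` gains `(ρ'/ρ)^k ≤ (ρ'/ρ)^K`. -/
theorem abs_outputCoeff_sub_truncSeq_le {τ ρ ρ' a : ℝ} {θ₀ : L2} (hρ' : 0 < ρ') (hρρ : ρ' < ρ)
    (hρτ : ρ < τ) (ha : ∀ n, |cosCoeff θ₀ n| ≤ a) (K N k : ℕ) :
    |outputCoeff τ θ₀ k - truncSeq τ θ₀ K N k| ≤
      √2 * (∑' n, gaussWeight (Real.pi ^ 2 * (τ - ρ) / 2) n) * a *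
        (Real.exp (-Real.log (ρ / ρ') * K) +
          Real.exp (-(Real.pi ^ 2 * (τ - ρ) / 2) * (N : ℝ) ^ 2)) * (k.factorial / ρ' ^ k) := by
  have hρ : 0 < ρ := hρ'.trans hρρ
  have ha0 : 0 ≤ a := (abs_nonneg _).trans (ha 0)
  have hS : 0 ≤ ∑' n, gaussWeight (Real.pi ^ 2 * (τ - ρ) / 2) n :=
    tsum_nonneg fun n => (Real.exp_pos _).le
  have hmono : (k.factorial : ℝ) / ρ ^ k ≤ k.factorial / ρ' ^ k := by gcongr
  rw [truncSeq]
  split_ifs with hk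
  · refine (abs_outputCoeff_sub_trunc_le hρ hρτ ha k N).trans ?_
    rw [gaussWeight]
    gcongr
    exact le_add_of_nonneg_left (Real.exp_pos _).le
  · rw [sub_zero]
    refine (abs_outputCoeff_le hρ hρτ ha k).trans ?_
    have e : Real.exp (-Real.log (ρ / ρ') * K) = (ρ' / ρ) ^ K := by
      rw [mul_comm, Real.exp_nat_mul, Real.exp_neg, Real.exp_log (by positivity), inv_div]
    have h1 : (k.factorial : ℝ) / ρ ^ k ≤ (ρ' / ρ) ^ K * (k.factorial / ρ' ^ k) := by
      calc (k.factorial : ℝ) / ρ ^ k = (ρ' / ρ) ^ k * (k.factorial / ρ' ^ k) := by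
            rw [div_pow]; field_simp
        _ ≤ _ := by
            gcongr ?_ * _
            exact pow_le_pow_of_le_one (by positivity) ((div_le_one hρ).2 hρρ.le) (by omega)
    rw [mul_assoc (√2 * _ * a)]
    gcongr
    refine h1.trans ?_
    rw [e]
    gcongr
    exact le_add_of_nonneg_right (Real.exp_pos _).le

theorem continuousOn_iteratedDeriv {y : ℝ → ℝ} {τ : ℝ}
    (hy : ∀ t, τ ≤ t → ContDiffAt ℝ (⊤ : ℕ∞) y t) (i : ℕ) :
    ContinuousOn (iteratedDeriv i y) (Ioi τ) := fun t ht =>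
  (contDiffAt_iteratedDeriv i (hy t (mem_Ioi.1 ht).le)).continuousAt.continuousWithinAt

/-- All the properties of the exact and truncated controls, in terms of a bound on the cosine
coefficients of the initial state. -/
theorem control_estimates {T τ R' s : ℝ} (hR' : 0 < R') (hR'τ : R' < τ)
    (hs₁ : 1 < s) (hs₂ : s < 2) :
    ∃ B C C₁ C₂ C₃ : ℝ, 0 < C ∧ 0 < C₁ ∧ 0 < C₂ ∧ 0 < C₃ ∧ ∀ (θ₀ : L2) (a : ℝ),
      (∀ n, |cosCoeff θ₀ n| ≤ a) →
      ControlWellDefined T s τ R' θ₀ ∧ (∀ t, |control s τ R' θ₀ t| ≤ B * a) ∧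
      ContinuousOn (control s τ R' θ₀) (Ioi τ) ∧ ∀ I K N : ℕ,
        ContinuousOn (truncControl s τ R' θ₀ I K N) (Ioi τ) ∧
        ∀ t, |control s τ R' θ₀ t - truncControl s τ R' θ₀ I K N t| ≤
          C * (Real.exp (-C₁ * ((I : ℝ) * Real.log I)) + Real.exp (-C₂ * K) +
            Real.exp (-C₃ * (N : ℝ) ^ 2)) * a := by
  -- The three gaps of `R' < ρ' < ρ < τ` serve, in order, the Cauchy estimates on `[τ, τ+R']`, the
  -- rate in `K` and the rate in `N`.
  obtain ⟨ρ', hρ'1, hρ'2⟩ := exists_between hR'τ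
  obtain ⟨ρ, hρ1, hρ2⟩ := exists_between hρ'2
  have hρ' : 0 < ρ' := hR'.trans hρ'1
  have hρ : 0 < ρ := hρ'.trans hρ1
  have hτ : 0 < τ := hR'.trans hR'τ
  have hc : 0 < Real.pi ^ 2 * (τ - ρ) / 2 := by
    have := Real.pi_pos; have : 0 < τ - ρ := by linarith
    positivity
  obtain ⟨C₀, M, hC₀, hM, hgev⟩ := cutoffSeries_gevrey hs₁ hR' hρ'1
  set S := √2 * ∑' n, gaussWeight (Real.pi ^ 2 * (τ - ρ) / 2) n with hS
  set W := C₀ * ∑' i, controlWeight s M i with hW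
  have hS0 : 0 < S := mul_pos (by positivity)
    ((summable_gaussWeight hc).tsum_pos (fun n => (Real.exp_pos _).le) 0 (Real.exp_pos _))
  have hws := summable_controlWeight hs₂ hM
  have hW0 : 0 < W := mul_pos hC₀
    (hws.tsum_pos (fun i => by unfold controlWeight; positivity) 0
      (by unfold controlWeight; positivity))
  refine ⟨S * W, S * W, (2 - s) / 4, Real.log (ρ / ρ'), Real.pi ^ 2 * (τ - ρ) / 2, by positivity,
    by linarith, Real.log_pos ((one_lt_div hρ').2 hρ1), hc, fun θ₀ a ha => ?_⟩
  have ha0 : 0 ≤ a := (abs_nonneg _).trans (ha 0)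
  have hycoef : ∀ k, |outputCoeff τ θ₀ k| ≤ S * a * (k.factorial / ρ' ^ k) := fun k =>
    (abs_outputCoeff_le hρ hρ2 ha k).trans (by rw [hS]; gcongr)
  have hSa : 0 ≤ S * a := by positivity
  have hy := hgev τ (S * a) (outputCoeff τ θ₀) hSa hycoef
  have hyterm : ∀ t, τ ≤ t → ∀ i, ‖iteratedDeriv (i + 1) (flatOutput s τ R' θ₀) t /
      ((2 * i + 1).factorial : ℝ)‖ ≤ S * a * C₀ * controlWeight s M i := fun t ht i =>
    abs_control_term_le' hs₂ hC₀.le hM hSa (hy t ht).2 i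
  have hcont : ∀ i, ContinuousOn (iteratedDeriv i (flatOutput s τ R' θ₀)) (Ioi τ) :=
    continuousOn_iteratedDeriv fun t ht => (hy t ht).1
  refine ⟨⟨fun k => summable_outputCoeffTerm hτ ha k, fun t ht => ?_, fun t ht => (hy t ht.1).1,
    fun t ht => Summable.of_norm_bounded (hws.mul_left (S * a * C₀)) (hyterm t ht.1)⟩, fun t => ?_,
    ?_, fun I K N => ?_⟩
  · refine summable_taylor hρ' hycoef (abs_lt.2 ⟨?_, ?_⟩)
    · linarith [ht.1]
    · linarith [ht.2]
  · rw [control]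
    split_ifs with ht
    · rw [abs_zero]; positivity
    · refine (tsum_of_norm_bounded (hws.hasSum.mul_left (S * a * C₀))
        (hyterm t (not_le.1 ht).le)).trans_eq ?_
      rw [hW]; ring
  · refine ContinuousOn.congr (f := fun t => ∑' i : ℕ,
      iteratedDeriv (i + 1) (flatOutput s τ R' θ₀) t / ((2 * i + 1).factorial : ℝ)) ?_
      fun t ht => if_neg (not_le.2 ht)
    exact continuousOn_tsum (fun i => (hcont (i + 1)).div_const _) (hws.mul_left (S * a * C₀))
      fun i t ht => hyterm t (mem_Ioi.1 ht).le i
  · set E := S * a * (Real.exp (-Real.log (ρ / ρ') * K) +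
      Real.exp (-(Real.pi ^ 2 * (τ - ρ) / 2) * (N : ℝ) ^ 2)) with hE
    have hE0 : 0 ≤ E := by positivity
    have hdcoef : ∀ k, |outputCoeff τ θ₀ k - truncSeq τ θ₀ K N k| ≤
        E * (k.factorial / ρ' ^ k) := abs_outputCoeff_sub_truncSeq_le hρ' hρ1 hρ2 ha K N
    -- This crude bound gives smoothness of the truncated output and convergence of its series; it
    -- does not enter the error.
    have hzcoef : ∀ k, |truncSeq τ θ₀ K N k| ≤ (S * a + E) * (k.factorial / ρ' ^ k) := fun k => by
      have h1 := hycoef k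
      have h2 := hdcoef k
      have h3 := abs_sub (outputCoeff τ θ₀ k) (outputCoeff τ θ₀ k - truncSeq τ θ₀ K N k)
      rw [sub_sub_cancel] at h3
      rw [add_mul]
      linarith
    have hz := hgev τ (S * a + E) (truncSeq τ θ₀ K N) (by positivity) hzcoef
    have hd := hgev τ E _ hE0 hdcoef
    rw [← truncFlatOutput_eq] at hz
    refine ⟨?_, fun t => ?_⟩
    · refine ContinuousOn.congr (f := fun t => ∑ i ∈ Finset.range I,
        iteratedDeriv (i + 1) (truncFlatOutput s τ R' θ₀ K N) t / ((2 * i + 1).factorial : ℝ)) ?_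
        fun t ht => if_neg (not_le.2 ht)
      exact continuousOn_finsetSum _ fun i _ =>
        (continuousOn_iteratedDeriv (fun t ht => (hz t ht).1) (i + 1)).div_const _
    · rw [control, truncControl]
      split_ifs with ht
      · rw [sub_zero, abs_zero]; positivity
      · have ht' := (not_le.1 ht).le
        refine (abs_controlSeries_sub_le hs₂ hC₀.le hM hSa hE0 (hy t ht').2 (fun i => ?_) I).trans
          (le_of_eq ?_)
        · rw [← iteratedDeriv_fun_sub ((hy t ht').1.of_le (by exact_mod_cast le_top))
            ((hz t ht').1.of_le (by exact_mod_cast le_top))]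
          refine le_trans (le_of_eq ?_) ((hd t ht').2 i)
          congr 1
          apply Filter.EventuallyEq.iteratedDeriv_eq
          -- Equality of derivatives at `t` needs the identity on a neighbourhood, possibly to the
          -- left of `τ`; the disc of radius `ρ'` leaves room.
          filter_upwards [Ioi_mem_nhds (show τ - ρ' < t by linarith)] with x hx
          rw [cutoffSeries_sub hR' hρ'1 hycoef hzcoef hx, truncFlatOutput_eq]
        · rw [hE, hW]; ring

/-! ### The cosine basis of `L²(0,1)` -/

/-- The orthonormal cosines `1, √2 cos(nπx)`. -/
noncomputable def cosMode (n : ℕ) (x : ℝ) : ℝ :=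
  if n = 0 then 1 else √2 * Real.cos (n * Real.pi * x)

theorem continuous_cosMode (n : ℕ) : Continuous (cosMode n) := by
  unfold cosMode; split_ifs <;> fun_prop

theorem abs_cosMode_le (n : ℕ) (x : ℝ) : |cosMode n x| ≤ √2 := by
  unfold cosMode
  split_ifs
  · rw [abs_one]; exact Real.one_le_sqrt.2 (by norm_num)
  · rw [abs_mul, abs_of_nonneg (Real.sqrt_nonneg 2)]
    exact mul_le_of_le_one_right (Real.sqrt_nonneg 2) (Real.abs_cos_le_one _)

theorem memLp_of_continuous {g : ℝ → ℝ} (hg : Continuous g) : MemLp g 2 unitMeasure := by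
  obtain ⟨C, hC⟩ := isCompact_Icc.exists_bound_of_continuousOn
    (hg.continuousOn (s := Icc (0 : ℝ) 1))
  exact MemLp.of_bound hg.aestronglyMeasurable C
    ((ae_restrict_iff' measurableSet_Ioo).2 (Eventually.of_forall fun x hx =>
      hC x (Ioo_subset_Icc_self hx)))

theorem inner_toLp (f : L2) {g : ℝ → ℝ} (hg : MemLp g 2 unitMeasure) :
    inner ℝ (hg.toLp g) f = ∫ x in Ioo (0 : ℝ) 1, f x * g x := by
  rw [L2.inner_def]
  refine integral_congr_ae ?_
  filter_upwards [hg.coeFn_toLp] with x hx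
  rw [hx]
  simp

theorem integrable_mul_continuous (f : L2) {g : ℝ → ℝ} (hg : Continuous g) :
    IntegrableOn (fun x => f x * g x) (Ioo (0 : ℝ) 1) :=
  (Lp.memLp f).integrable_mul (memLp_of_continuous hg)

theorem integral_cos_int (k : ℤ) :
    ∫ x in Ioo (0 : ℝ) 1, Real.cos (k * Real.pi * x) = if k = 0 then 1 else 0 := by
  rw [← integral_Ioc_eq_integral_Ioo, ← intervalIntegral.integral_of_le zero_le_one]
  split_ifs with hk
  · simp [hk]
  · have : (k : ℝ) * Real.pi ≠ 0 := mul_ne_zero (by exact_mod_cast hk) Real.pi_ne_zero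
    rw [intervalIntegral.integral_comp_mul_left (fun x => Real.cos x) this, integral_cos]
    simp [Real.sin_int_mul_pi]

theorem integral_cosMode_mul (n m : ℕ) :
    ∫ x in Ioo (0 : ℝ) 1, cosMode n x * cosMode m x = if n = m then 1 else 0 := by
  have hcos : ∀ n m : ℕ, ∫ x in Ioo (0 : ℝ) 1,
      Real.cos (n * Real.pi * x) * Real.cos (m * Real.pi * x) =
      ((if ((n : ℤ) - m) = 0 then 1 else 0) + if ((n : ℤ) + m) = 0 then 1 else 0) / 2 := by
    intro n m
    have hi : ∀ k : ℤ, IntegrableOn (fun x : ℝ => Real.cos (k * Real.pi * x)) (Ioo (0 : ℝ) 1) :=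
      fun k => (memLp_of_continuous (by fun_prop)).integrable (by norm_num)
    rw [← integral_cos_int, ← integral_cos_int, ← integral_add (hi _) (hi _),
      ← integral_div]
    congr 1
    ext x
    push_cast
    rw [show ((n : ℝ) - m) * Real.pi * x = n * Real.pi * x - m * Real.pi * x by ring,
      show ((n : ℝ) + m) * Real.pi * x = n * Real.pi * x + m * Real.pi * x by ring,
      Real.cos_sub, Real.cos_add]
    ring
  have h2 : √2 * √2 = 2 := Real.mul_self_sqrt (by norm_num)
  rcases Nat.eq_zero_or_pos n with hn | hn <;> rcases Nat.eq_zero_or_pos m with hm | hm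
  · simp [cosMode, hn, hm]
  · have := integral_cos_int m
    rw [if_neg (by omega)] at this
    simp only [cosMode, hn, if_true, if_neg hm.ne', one_mul, if_neg hm.ne]
    rw [integral_const_mul]
    simp only [Int.cast_natCast] at this
    rw [this, mul_zero]
  · have := integral_cos_int n
    rw [if_neg (by omega)] at this
    simp only [cosMode, hm, if_true, if_neg hn.ne', mul_one]
    rw [integral_const_mul]
    simp only [Int.cast_natCast] at this
    rw [this, mul_zero]
  · simp only [cosMode, if_neg hn.ne', if_neg hm.ne']
    rw [show (fun x : ℝ => √2 * Real.cos (n * Real.pi * x) * (√2 * Real.cos (m * Real.pi * x))) =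
      fun x : ℝ => 2 * (Real.cos (n * Real.pi * x) * Real.cos (m * Real.pi * x)) by
        ext x; linear_combination
          (Real.cos (n * Real.pi * x) * Real.cos (m * Real.pi * x)) * h2,
      integral_const_mul, hcos, if_neg (show ¬ ((n : ℤ) + m) = 0 by omega)]
    by_cases h : n = m
    · simp [h]
    · rw [if_neg (by omega), if_neg h]; norm_num

/-- The orthonormal cosines as elements of `L²(0,1)`. -/
noncomputable def modeVec (n : ℕ) : L2 := (memLp_of_continuous (continuous_cosMode n)).toLp _

theorem inner_modeVec (n : ℕ) (f : L2) :
    inner ℝ (modeVec n) f = ∫ x in Ioo (0 : ℝ) 1, f x * cosMode n x := inner_toLp f _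

theorem orthonormal_modeVec : Orthonormal ℝ modeVec := by
  rw [orthonormal_iff_ite]
  intro n m
  rw [inner_modeVec, eq_comm, ← integral_cosMode_mul n m]
  refine integral_congr_ae ?_
  filter_upwards [(memLp_of_continuous (continuous_cosMode m)).coeFn_toLp] with x hx
  rw [modeVec, hx, mul_comm]

/-- Completeness of the cosines. Orthogonality to them gives orthogonality to polynomials in `cos
πx`, which are uniformly dense in `C([0,1])` by Weierstrass in the variable `y = cos πx`; and an
`L²` function orthogonal to all continuous functions vanishes. -/
theorem eq_zero_of_forall_inner_modeVec {f : L2} (hf : ∀ n, inner ℝ (modeVec n) f = 0) :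
    f = 0 := by
  have h0 : ∀ m : ℤ, ∫ x in Ioo (0 : ℝ) 1, f x * Real.cos (m * Real.pi * x) = 0 := by
    intro m
    have hm : ∀ x : ℝ, Real.cos (m * Real.pi * x) = Real.cos (m.natAbs * Real.pi * x) := by
      intro x
      rcases Int.natAbs_eq m with h | h
      · rw [show (m : ℝ) = (m.natAbs : ℝ) from
          (congrArg (Int.cast : ℤ → ℝ) h).trans (Int.cast_natCast _)]
      · rw [show (m : ℝ) = -(m.natAbs : ℝ) from
          (congrArg (Int.cast : ℤ → ℝ) h).trans (by rw [Int.cast_neg, Int.cast_natCast]),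
          neg_mul, neg_mul, Real.cos_neg]
    have h := hf m.natAbs
    rw [inner_modeVec] at h
    simp only [hm]
    rcases eq_or_ne m.natAbs 0 with h1 | h1
    · rw [h1] at h ⊢
      simpa [cosMode] using h
    · simp only [cosMode, if_neg h1, mul_left_comm _ (√2)] at h
      rw [integral_const_mul] at h
      exact (mul_eq_zero.1 h).resolve_left (by positivity)
  -- The factor `cos(mπx)` makes the induction close: multiplying it by `cos πx` averages the cases
  -- `m + 1` and `m - 1`, hence integer `m`.
  have h1 : ∀ (k : ℕ) (m : ℤ), ∫ x in Ioo (0 : ℝ) 1,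
      f x * (Real.cos (m * Real.pi * x) * Real.cos (Real.pi * x) ^ k) = 0 := by
    intro k
    induction k with
    | zero => intro m; simpa using h0 m
    | succ k ih =>
      intro m
      have hi : ∀ m : ℤ, IntegrableOn (fun x => f x *
          (Real.cos (m * Real.pi * x) * Real.cos (Real.pi * x) ^ k)) (Ioo (0 : ℝ) 1) :=
        fun m => integrable_mul_continuous f (by fun_prop)
      have h2 := integral_add (hi (m + 1)) (hi (m - 1))
      rw [ih, ih, add_zero] at h2
      refine (integral_congr_ae (g := fun x => (f x * (Real.cos ((m + 1 : ℤ) * Real.pi * x) *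
        Real.cos (Real.pi * x) ^ k) + f x * (Real.cos ((m - 1 : ℤ) * Real.pi * x) *
        Real.cos (Real.pi * x) ^ k)) / 2) (Eventually.of_forall fun x => ?_)).trans
        (by rw [integral_div, h2, zero_div])
      push_cast
      rw [show ((m : ℝ) + 1) * Real.pi * x = m * Real.pi * x + Real.pi * x by ring,
        show ((m : ℝ) - 1) * Real.pi * x = m * Real.pi * x - Real.pi * x by ring,
        Real.cos_sub, Real.cos_add]
      ring
  have hpoly : ∀ p : Polynomial ℝ,
      ∫ x in Ioo (0 : ℝ) 1, f x * p.eval (Real.cos (Real.pi * x)) = 0 := by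
    intro p
    induction p using Polynomial.induction_on' with
    | add p q hp hq =>
      simp only [Polynomial.eval_add, mul_add]
      rw [integral_add (integrable_mul_continuous f (by fun_prop))
        (integrable_mul_continuous f (by fun_prop)), hp, hq, add_zero]
    | monomial k a =>
      simp only [Polynomial.eval_monomial, mul_left_comm _ a]
      rw [integral_const_mul]
      have := h1 k 0
      simp only [Int.cast_zero, zero_mul, Real.cos_zero, one_mul] at this
      rw [this, mul_zero]
  have hcont : ∀ g : ℝ → ℝ, Continuous g → ∫ x in Ioo (0 : ℝ) 1, f x * g x = 0 := by
    intro g hg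
    set J := ∫ x in Ioo (0 : ℝ) 1, |f x| with hJ
    have hfi : IntegrableOn (fun x => f x) (Ioo (0 : ℝ) 1) := by
      simpa using integrable_mul_continuous f (continuous_const (y := (1 : ℝ)))
    have hJ0 : 0 ≤ J := integral_nonneg fun x => abs_nonneg _
    have hb : ∀ ε > 0, |∫ x in Ioo (0 : ℝ) 1, f x * g x| ≤ ε * J := by
      intro ε hε
      obtain ⟨p, hp⟩ := exists_polynomial_near_of_continuousOn (-1) 1
        (fun y => g (Real.arccos y / Real.pi))
        (hg.comp (Real.continuous_arccos.div_const _)).continuousOn ε hε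
      have hsub : ∫ x in Ioo (0 : ℝ) 1, f x * g x =
          ∫ x in Ioo (0 : ℝ) 1, f x * (g x - p.eval (Real.cos (Real.pi * x))) := by
        simp only [mul_sub]
        rw [integral_sub (integrable_mul_continuous f hg)
          (integrable_mul_continuous f (by fun_prop)), hpoly, sub_zero]
      rw [hsub, hJ, ← integral_const_mul]
      refine norm_integral_le_of_norm_le (f := fun x => f x *
        (g x - p.eval (Real.cos (Real.pi * x)))) (hfi.abs.const_mul ε) ?_
      refine (ae_restrict_iff' measurableSet_Ioo).2 (Eventually.of_forall fun x hx => ?_)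
      have h2 := hp (Real.cos (Real.pi * x)) ⟨Real.neg_one_le_cos _, Real.cos_le_one _⟩
      rw [Real.arccos_cos (mul_nonneg Real.pi_pos.le hx.1.le)
        (mul_le_of_le_one_right Real.pi_pos.le hx.2.le), mul_div_cancel_left₀ _ Real.pi_ne_zero,
        abs_sub_comm] at h2
      rw [norm_mul, Real.norm_eq_abs, Real.norm_eq_abs, mul_comm]
      gcongr
    have h5 : |∫ x in Ioo (0 : ℝ) 1, f x * g x| ≤ 0 := by
      refine le_of_forall_pos_le_add fun ε hε => ?_
      have := hb (ε / (J + 1)) (by positivity)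
      refine this.trans ?_
      rw [zero_add, div_mul_eq_mul_div, div_le_iff₀ (by positivity)]
      nlinarith
    exact abs_nonpos_iff.1 h5
  rw [Lp.ext_iff]
  have hfi : IntegrableOn (fun x => f x) (Ioo (0 : ℝ) 1) := by
    simpa using integrable_mul_continuous f (continuous_const (y := (1 : ℝ)))
  have hae := isOpen_Ioo.ae_eq_zero_of_integral_contDiff_smul_eq_zero (μ := volume)
    (f := fun x => f x) hfi.locallyIntegrableOn fun g hg _ hsupp => by
      have := hcont g hg.continuous
      rw [setIntegral_eq_integral_of_forall_compl_eq_zero] at this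
      · rw [← this]
        congr 1
        ext x
        rw [smul_eq_mul, mul_comm]
      · intro x hx
        rw [image_eq_zero_of_notMem_tsupport fun h => hx (hsupp h), mul_zero]
  filter_upwards [(ae_restrict_iff' measurableSet_Ioo).2 hae, Lp.coeFn_zero ℝ 2 unitMeasure]
    with x hx hx0
  rw [hx, hx0]
  rfl

/-- The Hilbert basis of cosines of `L²(0,1)`. -/
noncomputable def cosBasis : HilbertBasis ℕ ℝ L2 :=
  HilbertBasis.mkOfOrthogonalEqBot orthonormal_modeVec (by
    rw [Submodule.eq_bot_iff]
    intro f hf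
    exact eq_zero_of_forall_inner_modeVec fun n =>
      (Submodule.mem_orthogonal _ _).1 hf _ (Submodule.subset_span ⟨n, rfl⟩))

theorem cosBasis_apply (n : ℕ) : cosBasis n = modeVec n := by
  rw [cosBasis, HilbertBasis.coe_mkOfOrthogonalEqBot]

/-- The coordinates of `f` in the cosine basis. -/
noncomputable def modeCoeff (f : L2) (n : ℕ) : ℝ := ∫ x in Ioo (0 : ℝ) 1, f x * cosMode n x

theorem repr_cosBasis (f : L2) (n : ℕ) : cosBasis.repr f n = modeCoeff f n := by
  rw [HilbertBasis.repr_apply_apply, cosBasis_apply, inner_modeVec, modeCoeff]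

theorem inner_cosBasis (f : L2) (n : ℕ) : inner ℝ (cosBasis n) f = modeCoeff f n := by
  rw [cosBasis_apply, inner_modeVec, modeCoeff]

theorem eq_of_modeCoeff_eq {f g : L2} (h : ∀ n, modeCoeff f n = modeCoeff g n) : f = g := by
  apply cosBasis.repr.injective
  ext n
  rw [repr_cosBasis, repr_cosBasis, h]

theorem abs_modeCoeff_le (f : L2) (n : ℕ) : |modeCoeff f n| ≤ ‖f‖ := by
  rw [← inner_cosBasis]
  refine (abs_real_inner_le_norm _ _).trans_eq ?_
  rw [cosBasis.orthonormal.1 n, one_mul]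

theorem abs_cosCoeff_le (f : L2) (n : ℕ) : |cosCoeff f n| ≤ ‖f‖ := by
  have h := abs_modeCoeff_le f n
  rw [modeCoeff] at h
  unfold cosCoeff
  split_ifs with hn
  · simp only [cosMode, hn, if_true, mul_one] at h
    rw [abs_div, abs_of_nonneg (Real.sqrt_nonneg 2)]
    exact (div_le_self (abs_nonneg _) (Real.one_le_sqrt.2 (by norm_num))).trans h
  · simp only [cosMode, if_neg hn, mul_left_comm _ (√2)] at h
    rwa [integral_const_mul] at h

theorem modeCoeff_sub (f g : L2) (n : ℕ) :
    modeCoeff (f - g) n = modeCoeff f n - modeCoeff g n := by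
  simp only [← inner_cosBasis, inner_sub_right]

theorem modeCoeff_toLp {g : ℝ → ℝ} (hg : Continuous g) (n : ℕ) :
    modeCoeff ((memLp_of_continuous hg).toLp g) n = ∫ x in Ioo (0 : ℝ) 1, g x * cosMode n x := by
  refine integral_congr_ae ?_
  filter_upwards [(memLp_of_continuous hg).coeFn_toLp] with x hx
  rw [hx]

theorem hasSum_modeCoeff_mul (f : L2) {g : ℝ → ℝ} (hg : Continuous g) :
    HasSum (fun n => modeCoeff f n * ∫ x in Ioo (0 : ℝ) 1, g x * cosMode n x)
      (∫ x in Ioo (0 : ℝ) 1, f x * g x) := by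
  have h := cosBasis.hasSum_inner_mul_inner ((memLp_of_continuous hg).toLp g) f
  rw [inner_toLp] at h
  have e : ∀ n, inner ℝ ((memLp_of_continuous hg).toLp g) (cosBasis n) * inner ℝ (cosBasis n) f =
      modeCoeff f n * ∫ x in Ioo (0 : ℝ) 1, g x * cosMode n x := fun n => by
    rw [real_inner_comm, inner_cosBasis, inner_cosBasis, modeCoeff_toLp hg, mul_comm]
  simpa only [e] using h

theorem continuous_cosSeries {c : ℕ → ℝ} (hc : Summable fun n => |c n|) :
    Continuous fun x => ∑' n, c n * cosMode n x := by
  refine continuous_tsum (fun n => continuous_const.mul (continuous_cosMode n))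
    (hc.mul_right √2) fun n x => ?_
  rw [norm_mul]
  exact mul_le_mul_of_nonneg_left (abs_cosMode_le n x) (abs_nonneg _)

/-- An `L²` function with absolutely summable cosine coefficients is the sum of its series. -/
theorem ae_eq_cosSeries {f : L2} (hf : Summable fun n => |modeCoeff f n|) :
    f =ᵐ[unitMeasure] fun x => ∑' n, modeCoeff f n * cosMode n x := by
  have hg := continuous_cosSeries hf
  have key : f = (memLp_of_continuous hg).toLp _ := by
    refine eq_of_modeCoeff_eq fun m => ?_
    rw [modeCoeff_toLp hg]
    have hint : ∀ n, Integrable (fun x => modeCoeff f n * cosMode n x * cosMode m x) unitMeasure :=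
      fun n => (memLp_of_continuous ((continuous_const.mul (continuous_cosMode n)).mul
        (continuous_cosMode m))).integrable (by norm_num)
    have hs := hasSum_integral_of_summable_integral_norm hint (by
      refine Summable.of_nonneg_of_le (fun n => integral_nonneg fun x => norm_nonneg _)
        (fun n => ?_) (hf.mul_right (√2 * √2))
      calc ∫ x in Ioo (0 : ℝ) 1, ‖modeCoeff f n * cosMode n x * cosMode m x‖
          ≤ ∫ x in Ioo (0 : ℝ) 1, |modeCoeff f n| * (√2 * √2) := by
            refine integral_mono (hint n).norm (integrable_const _) fun x => ?_
            simp only [norm_mul, Real.norm_eq_abs, mul_assoc]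
            gcongr
            · exact abs_cosMode_le n x
            · exact abs_cosMode_le m x
        _ = _ := by simp)
    simp only [mul_assoc, integral_const_mul, integral_cosMode_mul] at hs
    have h1 : HasSum (fun n => modeCoeff f n * if n = m then (1 : ℝ) else 0) (modeCoeff f m) := by
      simpa using hasSum_single (f := fun n => modeCoeff f n * if n = m then (1 : ℝ) else 0) m
        fun n hn => by simp [hn]
    rw [h1.unique hs]
    congr 1
    ext x
    rw [← tsum_mul_right]
    exact tsum_congr fun n => by ring
  have := (memLp_of_continuous hg).coeFn_toLp
  rwa [← key] at this

/-- Continuity turns a.e. equality into equality up to the endpoints; the value at `x = 1`, where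
the control acts, is what is needed. -/
theorem eq_cosSeries {g : ℝ → ℝ} (hg : Continuous g)
    (hs : Summable fun n => |∫ x in Ioo (0 : ℝ) 1, g x * cosMode n x|) {x : ℝ}
    (hx : x ∈ Icc (0 : ℝ) 1) :
    g x = ∑' n, (∫ x in Ioo (0 : ℝ) 1, g x * cosMode n x) * cosMode n x := by
  have hs' : Summable fun n => |modeCoeff ((memLp_of_continuous hg).toLp g) n| := by
    simpa only [modeCoeff_toLp hg] using hs
  have h := ae_eq_cosSeries hs'
  simp only [modeCoeff_toLp hg] at h
  have h2 : g =ᵐ[volume.restrict (Icc (0 : ℝ) 1)]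
      fun x => ∑' n, (∫ x in Ioo (0 : ℝ) 1, g x * cosMode n x) * cosMode n x := by
    rw [← restrict_Ioo_eq_restrict_Icc]
    exact (memLp_of_continuous hg).coeFn_toLp.symm.trans h
  exact Measure.eqOn_Icc_of_ae_eq volume zero_ne_one h2 hg.continuousOn
    (continuous_cosSeries hs).continuousOn hx

/-! ### Eigenvalues and test functions -/

/-- The Neumann eigenvalue `n²π²`. -/
noncomputable def eigen (n : ℕ) : ℝ := ((n : ℝ) * Real.pi) ^ 2

/-- The inverse eigenvalue, with value `1` for the zero mode. -/
noncomputable def invEigen (n : ℕ) : ℝ := if n = 0 then 1 else (eigen n)⁻¹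

theorem eigen_nonneg (n : ℕ) : 0 ≤ eigen n := sq_nonneg _

theorem invEigen_nonneg (n : ℕ) : 0 ≤ invEigen n := by
  unfold invEigen; split_ifs
  · exact zero_le_one
  · exact inv_nonneg.2 (eigen_nonneg n)

theorem eigen_mul_invEigen {n : ℕ} (hn : n ≠ 0) : eigen n * invEigen n = 1 := by
  rw [invEigen, if_neg hn, mul_inv_cancel₀]
  have := Real.pi_pos
  have : (0 : ℝ) < n := by exact_mod_cast Nat.pos_of_ne_zero hn
  unfold eigen
  positivity

theorem invEigen_le_one (n : ℕ) : invEigen n ≤ 1 := by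
  rcases eq_or_ne n 0 with hn | hn
  · rw [invEigen, if_pos hn]
  · have h1 := eigen_mul_invEigen hn
    have h2 : 1 ≤ eigen n := by
      have a1 : (1 : ℝ) ≤ n := by exact_mod_cast Nat.one_le_iff_ne_zero.2 hn
      have a2 : (1 : ℝ) ≤ Real.pi := by linarith [Real.pi_gt_three]
      exact one_le_pow₀ (by nlinarith)
    nlinarith [invEigen_nonneg n]

theorem summable_invEigen : Summable invEigen := by
  refine (summable_nat_add_iff 1).1 ?_
  have h := ((summable_nat_add_iff 1).2 (Real.summable_nat_pow_inv.2 one_lt_two)).mul_right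
    ((Real.pi ^ 2)⁻¹)
  refine h.congr fun n => ?_
  rw [invEigen, if_neg n.succ_ne_zero, eigen, mul_pow, mul_inv]

theorem cosMode_eq (n : ℕ) (x : ℝ) :
    cosMode n x = cosMode n 0 * Real.cos (n * Real.pi * x) := by
  unfold cosMode
  split_ifs with hn <;> simp [hn]

theorem contDiff_cosMode (n : ℕ) : ContDiff ℝ 2 (cosMode n) := by
  rw [show cosMode n = fun x => cosMode n 0 * Real.cos (n * Real.pi * x) from
    funext (cosMode_eq n)]
  fun_prop

theorem hasDerivAt_cosMode (n : ℕ) (x : ℝ) :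
    HasDerivAt (cosMode n) (cosMode n 0 * (-Real.sin (n * Real.pi * x) * (n * Real.pi))) x := by
  have h : HasDerivAt (fun x : ℝ => (n : ℝ) * Real.pi * x) ((n : ℝ) * Real.pi) x := by
    simpa using (hasDerivAt_id x).const_mul ((n : ℝ) * Real.pi)
  exact (h.cos.const_mul (cosMode n 0)).congr_of_eventuallyEq (Eventually.of_forall (cosMode_eq n))

theorem hasDerivAt_deriv_cosMode (n : ℕ) (x : ℝ) :
    HasDerivAt (fun x => cosMode n 0 * (-Real.sin (n * Real.pi * x) * (n * Real.pi)))
      (-eigen n * cosMode n x) x := by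
  have h : HasDerivAt (fun x : ℝ => (n : ℝ) * Real.pi * x) ((n : ℝ) * Real.pi) x := by
    simpa using (hasDerivAt_id x).const_mul ((n : ℝ) * Real.pi)
  refine ((h.sin.neg.mul_const ((n : ℝ) * Real.pi)).const_mul (cosMode n 0)).congr_deriv ?_
  rw [cosMode_eq n x, eigen]
  ring

theorem deriv_cosMode (n : ℕ) :
    deriv (cosMode n) = fun x => cosMode n 0 * (-Real.sin (n * Real.pi * x) * (n * Real.pi)) :=
  funext fun x => (hasDerivAt_cosMode n x).deriv

theorem deriv_deriv_cosMode (n : ℕ) (x : ℝ) :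
    deriv (deriv (cosMode n)) x = -eigen n * cosMode n x := by
  rw [deriv_cosMode]; exact (hasDerivAt_deriv_cosMode n x).deriv

theorem deriv_cosMode_zero (n : ℕ) : deriv (cosMode n) 0 = 0 := by
  rw [deriv_cosMode]; simp

theorem deriv_cosMode_one (n : ℕ) : deriv (cosMode n) 1 = 0 := by
  rw [deriv_cosMode]; simp [Real.sin_nat_mul_pi]

/-- Green's formula against a mode for a function satisfying the Neumann conditions. -/
theorem integral_deriv_deriv_mul_cosMode {φ : ℝ → ℝ} (hφ : ContDiff ℝ 2 φ) (h0 : deriv φ 0 = 0)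
    (h1 : deriv φ 1 = 0) (n : ℕ) :
    ∫ x in Ioo (0 : ℝ) 1, deriv (deriv φ) x * cosMode n x =
      -eigen n * ∫ x in Ioo (0 : ℝ) 1, φ x * cosMode n x := by
  have hφ' : ContDiff ℝ 1 (deriv φ) := by
    rw [show (2 : WithTop ℕ∞) = 1 + 1 by norm_num, contDiff_succ_iff_deriv] at hφ
    exact hφ.2.2
  have hc' : Continuous (deriv (deriv φ)) := hφ'.continuous_deriv le_rfl
  have d1 : ∀ x, HasDerivAt φ (deriv φ x) x := fun x =>
    (hφ.differentiable (by norm_num) x).hasDerivAt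
  have d2 : ∀ x, HasDerivAt (deriv φ) (deriv (deriv φ) x) x := fun x =>
    (hφ'.differentiable (by norm_num) x).hasDerivAt
  have c2 : Continuous (deriv (cosMode n)) := by rw [deriv_cosMode]; fun_prop
  have e1 := intervalIntegral.integral_deriv_mul_eq_sub (a := 0) (b := 1) (u := deriv φ)
    (v := cosMode n) (u' := deriv (deriv φ)) (v' := deriv (cosMode n)) (fun x _ => d2 x)
    (fun x _ => (hasDerivAt_cosMode n x).differentiableAt.hasDerivAt)
    (hc'.intervalIntegrable _ _) (c2.intervalIntegrable _ _)
  have e2 := intervalIntegral.integral_deriv_mul_eq_sub (a := 0) (b := 1) (u := φ)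
    (v := deriv (cosMode n)) (u' := deriv φ) (v' := fun x => -eigen n * cosMode n x)
    (fun x _ => d1 x)
    (fun x _ => by rw [deriv_cosMode]; exact hasDerivAt_deriv_cosMode n x)
    (hφ'.continuous.intervalIntegrable _ _)
    ((continuous_const.mul (continuous_cosMode n)).intervalIntegrable _ _)
  have i1 : IntervalIntegrable (fun x => deriv (deriv φ) x * cosMode n x) volume 0 1 :=
    (hc'.mul (continuous_cosMode n)).intervalIntegrable _ _
  have i2 : IntervalIntegrable (fun x => deriv φ x * deriv (cosMode n) x) volume 0 1 :=
    (hφ'.continuous.mul c2).intervalIntegrable _ _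
  have i3 : IntervalIntegrable (fun x => φ x * (-eigen n * cosMode n x)) volume 0 1 :=
    (hφ.continuous.mul (continuous_const.mul (continuous_cosMode n))).intervalIntegrable _ _
  rw [intervalIntegral.integral_add i1 i2, h0, h1] at e1
  rw [intervalIntegral.integral_add i2 i3, deriv_cosMode_zero, deriv_cosMode_one] at e2
  simp only [mul_left_comm _ (-eigen n), intervalIntegral.integral_const_mul] at e2
  rw [intervalIntegral.integral_of_le zero_le_one, intervalIntegral.integral_of_le zero_le_one,
    integral_Ioc_eq_integral_Ioo, integral_Ioc_eq_integral_Ioo] at e1 e2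
  linarith

/-! ### Controls vanishing up to time `τ` -/

/-- A control which vanishes up to time `τ`, is continuous afterwards, and is bounded by `B`. -/
structure IsDelayedControl (τ B : ℝ) (u : ℝ → ℝ) : Prop where
  zero : ∀ t ≤ τ, u t = 0
  cont : ContinuousOn u (Ioi τ)
  bound : ∀ t, |u t| ≤ B

namespace IsDelayedControl

variable {τ B : ℝ} {u : ℝ → ℝ}

theorem continuousAt (hu : IsDelayedControl τ B u) {t : ℝ} (ht : t ≠ τ) : ContinuousAt u t := by
  rcases ht.lt_or_gt with ht | ht
  · refine (continuousAt_const (y := (0 : ℝ))).congr ?_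
    filter_upwards [Iio_mem_nhds ht] with x hx using (hu.zero x (mem_Iio.1 hx).le).symm
  · exact hu.cont.continuousAt (Ioi_mem_nhds ht)

theorem aestronglyMeasurable (hu : IsDelayedControl τ B u) : AEStronglyMeasurable u volume := by
  have e : (Ioi τ).indicator u = u := by
    ext t
    by_cases ht : t ∈ Ioi τ
    · rw [indicator_of_mem ht]
    · rw [indicator_of_notMem ht, hu.zero t (not_lt.1 ht)]
  rw [← e, aestronglyMeasurable_indicator_iff measurableSet_Ioi]
  exact hu.cont.aestronglyMeasurable measurableSet_Ioi

theorem memLp (hu : IsDelayedControl τ B u) (T : ℝ) :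
    MemLp u 2 (volume.restrict (Ioo (0 : ℝ) T)) :=
  MemLp.of_bound hu.aestronglyMeasurable.restrict B (Eventually.of_forall hu.bound)

theorem intervalIntegrable_mul (hu : IsDelayedControl τ B u) {g : ℝ → ℝ} (hg : Continuous g)
    (a b : ℝ) : IntervalIntegrable (fun t => g t * u t) volume a b := by
  have h : IntervalIntegrable u volume a b := by
    rw [intervalIntegrable_iff]
    exact Measure.integrableOn_of_bounded (M := B) (by simp) hu.aestronglyMeasurable
      (Eventually.of_forall hu.bound)
  exact h.continuousOn_mul hg.continuousOn

theorem intervalIntegrable (hu : IsDelayedControl τ B u) (a b : ℝ) :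
    IntervalIntegrable u volume a b := by
  simpa using hu.intervalIntegrable_mul (continuous_const (y := (1 : ℝ))) a b

end IsDelayedControl

/-! ### The scalar modes -/

/-- The solution of `a' = -l a + β u`, `a(0) = c`. -/
noncomputable def modeSol (l β c : ℝ) (u : ℝ → ℝ) (t : ℝ) : ℝ :=
  Real.exp (-l * t) * (c + β * ∫ r in (0 : ℝ)..t, Real.exp (l * r) * u r)

variable {τ B : ℝ} {u : ℝ → ℝ}

theorem continuous_modeSol (hu : IsDelayedControl τ B u) (l β c : ℝ) :
    Continuous (modeSol l β c u) := by
  have h : Continuous fun t => ∫ r in (0 : ℝ)..t, Real.exp (l * r) * u r :=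
    intervalIntegral.continuous_primitive (fun a b => hu.intervalIntegrable_mul (by fun_prop) a b) 0
  unfold modeSol
  fun_prop

/-- The control may jump at `τ`, so the fundamental theorem of calculus is applied with that single
exceptional point. -/
theorem modeSol_integral_eq (hu : IsDelayedControl τ B u) (l β c t : ℝ) :
    modeSol l β c u t = c + ∫ r in (0 : ℝ)..t, (-l * modeSol l β c u r + β * u r) := by
  have hd : ∀ r, r ≠ τ → HasDerivAt (modeSol l β c u) (-l * modeSol l β c u r + β * u r) r := by
    intro r hr
    have h1 : HasDerivAt (fun t => ∫ r in (0 : ℝ)..t, Real.exp (l * r) * u r)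
        (Real.exp (l * r) * u r) r := by
      refine intervalIntegral.integral_hasDerivAt_right (hu.intervalIntegrable_mul (by fun_prop) _ _)
        ?_ (ContinuousAt.mul (by fun_prop) (hu.continuousAt hr))
      exact AEStronglyMeasurable.stronglyMeasurableAtFilter
        (Continuous.aestronglyMeasurable (by fun_prop) |>.mul hu.aestronglyMeasurable)
    have h2 : HasDerivAt (fun t => Real.exp (-l * t)) (Real.exp (-l * r) * -l) r := by
      simpa using ((hasDerivAt_id r).const_mul (-l)).exp
    refine (h2.mul ((h1.const_mul β).const_add c)).congr_deriv ?_
    have h3 : Real.exp (-l * r) * Real.exp (l * r) = 1 := by rw [← Real.exp_add]; simp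
    rw [modeSol]
    linear_combination (β * u r) * h3
  have hc := continuous_modeSol hu l β c
  have := integral_eq_of_hasDerivAt_off_countable (modeSol l β c u)
    (fun r => -l * modeSol l β c u r + β * u r) (a := 0) (b := t) (countable_singleton τ)
    hc.continuousOn (fun r hr => hd r hr.2)
    (((continuous_const.mul hc).intervalIntegrable _ _).add
      ((hu.intervalIntegrable _ _).const_mul β))
  rw [this]
  simp [modeSol]

/-- A priori bound for the scalar modes. -/
theorem abs_mode_le {T l b w₀ t : ℝ} {w v : ℝ → ℝ} (hv : IsDelayedControl τ b v) (hl : 0 ≤ l)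
    (hwc : ContinuousOn w (Icc 0 T))
    (hw : ∀ t ∈ Icc (0 : ℝ) T, w t = w₀ + ∫ r in (0 : ℝ)..t, (-l * w r + v r))
    (ht : t ∈ Icc 0 T) :
    |w t| ≤ |w₀| + b * T ∧ l * |w t| ≤ l * |w₀| + b := by
  have hb : 0 ≤ b := (abs_nonneg _).trans (hv.bound 0)
  have h0t := ht.1
  have hsub : uIcc 0 t ⊆ Icc 0 T := by
    rw [uIcc_of_le ht.1]; exact Icc_subset_Icc_right ht.2
  have hint : ∀ r ∈ Icc 0 T, IntervalIntegrable (fun r => -l * w r + v r) volume 0 r := by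
    intro r hr
    have : uIcc 0 r ⊆ Icc 0 T := by rw [uIcc_of_le hr.1]; exact Icc_subset_Icc_right hr.2
    exact ((continuousOn_const.mul (hwc.mono this)).intervalIntegrable).add
      (hv.intervalIntegrable _ _)
  have hd : ∀ r ∈ Ioo 0 T, r ≠ τ → HasDerivAt w (-l * w r + v r) r := by
    intro r hr hne
    have hwr : ContinuousAt w r := hwc.continuousAt (Icc_mem_nhds hr.1 hr.2)
    have h1 : HasDerivAt (fun t => ∫ r in (0 : ℝ)..t, (-l * w r + v r)) (-l * w r + v r) r := by
      refine intervalIntegral.integral_hasDerivAt_right (hint r ⟨hr.1.le, hr.2.le⟩) ?_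
        ((continuousAt_const.mul hwr).add (hv.continuousAt hne))
      refine ⟨Icc 0 T, Icc_mem_nhds hr.1 hr.2, ?_⟩
      exact ((continuousOn_const.mul hwc).aestronglyMeasurable measurableSet_Icc).add
        hv.aestronglyMeasurable.restrict
    refine (h1.const_add w₀).congr_of_eventuallyEq ?_
    filter_upwards [Icc_mem_nhds hr.1 hr.2] with x hx using hw x hx
  -- Integrating factor: off `τ`, the derivative of `e^{lr} w` is `e^{lr} v`.
  have hg := integral_eq_of_hasDerivAt_off_countable (fun r => Real.exp (l * r) * w r)
    (fun r => Real.exp (l * r) * v r) (a := 0) (b := t) (countable_singleton τ)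
    (ContinuousOn.mul (by fun_prop) (hwc.mono hsub)) (fun r hr => by
      rw [min_eq_left ht.1, max_eq_right ht.1] at hr
      have h2 : HasDerivAt (fun t => Real.exp (l * t)) (Real.exp (l * r) * l) r := by
        simpa using ((hasDerivAt_id r).const_mul l).exp
      refine (h2.mul (hd r ⟨hr.1.1, hr.1.2.trans_le ht.2⟩ hr.2)).congr_deriv ?_
      ring) (hv.intervalIntegrable_mul (by fun_prop) _ _)
  have hw0 : w 0 = w₀ := by simpa using hw 0 ⟨le_rfl, ht.1.trans ht.2⟩
  simp only [mul_zero, Real.exp_zero, one_mul, hw0] at hg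
  have hE : 0 < Real.exp (l * t) := Real.exp_pos _
  have hE1 : 1 ≤ Real.exp (l * t) := Real.one_le_exp (mul_nonneg hl ht.1)
  have hle : |∫ r in (0 : ℝ)..t, Real.exp (l * r) * v r| ≤
      ∫ r in (0 : ℝ)..t, Real.exp (l * r) * b := by
    refine intervalIntegral.norm_integral_le_of_norm_le (f := fun r => Real.exp (l * r) * v r)
      ht.1 (Eventually.of_forall fun r _ => ?_)
      (Continuous.intervalIntegrable (by fun_prop) _ _)
    rw [norm_mul, Real.norm_eq_abs, Real.abs_exp]
    exact mul_le_mul_of_nonneg_left (hv.bound r) (Real.exp_pos _).le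
  have hmain : Real.exp (l * t) * |w t| ≤
      |w₀| + ∫ r in (0 : ℝ)..t, Real.exp (l * r) * b := by
    rw [← abs_of_pos hE, ← abs_mul, show Real.exp (l * t) * w t =
      w₀ + ∫ r in (0 : ℝ)..t, Real.exp (l * r) * v r by linarith]
    exact (abs_add_le _ _).trans (by linarith)
  -- Bounding `e^{lr}` by `e^{lt}` gives an estimate valid also for `l = 0`; integrating `e^{lr}`
  -- exactly gains the factor `1/l`.
  constructor
  · have h3 : ∫ r in (0 : ℝ)..t, Real.exp (l * r) * b ≤ ∫ r in (0 : ℝ)..t, Real.exp (l * t) * b := by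
      refine intervalIntegral.integral_mono_on ht.1
        (Continuous.intervalIntegrable (by fun_prop) _ _) (by simp) fun r hr => ?_
      have := hr.2
      gcongr
    rw [intervalIntegral.integral_const, sub_zero, smul_eq_mul] at h3
    have h4 : Real.exp (l * t) * |w t| ≤ Real.exp (l * t) * (|w₀| + b * T) := by
      have : t * b ≤ T * b := by have := ht.2; gcongr
      nlinarith [abs_nonneg w₀]
    exact le_of_mul_le_mul_left h4 hE
  · have h5 : l * ∫ r in (0 : ℝ)..t, Real.exp (l * r) * b = (Real.exp (l * t) - 1) * b := by
      rw [intervalIntegral.integral_mul_const, ← mul_assoc,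
        ← intervalIntegral.integral_const_mul,
        intervalIntegral.integral_eq_sub_of_hasDerivAt (f := fun t => Real.exp (l * t))
          (fun r _ => by simpa [mul_comm l] using ((hasDerivAt_id r).const_mul l).exp)
          (Continuous.intervalIntegrable (by fun_prop) _ _)]
      simp
    have h6 : Real.exp (l * t) * (l * |w t|) ≤ Real.exp (l * t) * (l * |w₀| + b) := by
      have := mul_le_mul_of_nonneg_left hmain hl
      nlinarith [mul_nonneg hl (abs_nonneg w₀)]
    exact le_of_mul_le_mul_left h6 hE

/-- The zero mode has no damping and uses the first bound, the others the second. The summable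
factor is what later yields a sup-norm estimate. -/
theorem abs_mode_le_invEigen {T b w₀ t : ℝ} {n : ℕ} {w v : ℝ → ℝ} (hv : IsDelayedControl τ b v)
    (hwc : ContinuousOn w (Icc 0 T))
    (hw : ∀ t ∈ Icc (0 : ℝ) T, w t = w₀ + ∫ r in (0 : ℝ)..t, (-eigen n * w r + v r))
    (ht : t ∈ Icc 0 T) :
    |w t| ≤ |w₀| + b * (1 + T) * invEigen n := by
  have hb : 0 ≤ b := (abs_nonneg _).trans (hv.bound 0)
  have hT : 0 ≤ T := ht.1.trans ht.2
  obtain ⟨h1, h2⟩ := abs_mode_le hv (eigen_nonneg n) hwc hw ht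
  rcases eq_or_ne n 0 with hn | hn
  · rw [invEigen, if_pos hn]; nlinarith
  · have h3 := eigen_mul_invEigen hn
    have h4 := invEigen_nonneg n
    have h5 := mul_le_mul_of_nonneg_left h2 h4
    have h6 : |w t| ≤ |w₀| + b * invEigen n := by
      calc |w t| = invEigen n * (eigen n * |w t|) := by
            rw [← mul_assoc, mul_comm (invEigen n), h3, one_mul]
        _ ≤ invEigen n * (eigen n * |w₀| + b) := h5
        _ = (eigen n * invEigen n) * |w₀| + b * invEigen n := by ring
        _ = _ := by rw [h3, one_mul]
    nlinarith [mul_nonneg (mul_nonneg hb hT) h4]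

/-! ### Solutions of the heat equation by modes -/

theorem hasSum_modeCoeff_sq (f : L2) : HasSum (fun n => modeCoeff f n ^ 2) (‖f‖ ^ 2) := by
  have h := cosBasis.hasSum_inner_mul_inner f f
  have e : ∀ n, inner ℝ f (cosBasis n) * inner ℝ (cosBasis n) f = modeCoeff f n ^ 2 := fun n => by
    rw [real_inner_comm, inner_cosBasis, sq]
  simpa only [e, real_inner_self_eq_norm_sq] using h

theorem exists_modeCoeff_eq {a : ℕ → ℝ} (ha : Summable fun n => a n ^ 2) :
    ∃ f : L2, ∀ n, modeCoeff f n = a n := by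
  have hm : Memℓp a 2 := by
    refine memℓp_gen ?_
    simpa using ha
  refine ⟨cosBasis.repr.symm ⟨a, hm⟩, fun n => ?_⟩
  rw [← repr_cosBasis, LinearIsometryEquiv.apply_symm_apply]

/-- By Parseval, the squared distance is a sum of squares dominated by `4 b_n²`, so dominated
convergence applies. -/
theorem continuousOn_of_modeCoeff {θ : ℝ → L2} {S : Set ℝ} {b : ℕ → ℝ}
    (hb : Summable fun n => b n ^ 2)
    (hc : ∀ n, ContinuousOn (fun t => modeCoeff (θ t) n) S)
    (hle : ∀ n, ∀ t ∈ S, |modeCoeff (θ t) n| ≤ b n) : ContinuousOn θ S := by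
  intro t₀ ht₀
  rw [ContinuousWithinAt, tendsto_iff_norm_sub_tendsto_zero]
  have h : Tendsto (fun t => ∑' n, modeCoeff (θ t - θ t₀) n ^ 2) (𝓝[S] t₀)
      (𝓝 (∑' _ : ℕ, (0 : ℝ))) := by
    refine tendsto_tsum_of_dominated_convergence (hb.mul_left 4) (fun n => ?_) ?_
    · have h1 : Tendsto (fun t => (modeCoeff (θ t) n - modeCoeff (θ t₀) n) ^ 2) (𝓝[S] t₀)
          (𝓝 ((modeCoeff (θ t₀) n - modeCoeff (θ t₀) n) ^ 2)) :=
        ((hc n t₀ ht₀).tendsto.sub_const _).pow 2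
      simpa [modeCoeff_sub] using h1
    · filter_upwards [self_mem_nhdsWithin] with t ht n
      rw [modeCoeff_sub, Real.norm_of_nonneg (sq_nonneg _)]
      have h1 := hle n t ht
      have h2 := hle n t₀ ht₀
      have h3 := (abs_sub (modeCoeff (θ t) n) (modeCoeff (θ t₀) n)).trans (add_le_add h1 h2)
      calc (modeCoeff (θ t) n - modeCoeff (θ t₀) n) ^ 2 ≤ (b n + b n) ^ 2 := sq_le_sq'
            (by linarith [(abs_le.1 h3).1]) (abs_le.1 h3).2
        _ = 4 * b n ^ 2 := by ring
  rw [tsum_zero] at h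
  have h2 := (Real.continuous_sqrt.tendsto _).comp h
  rw [Real.sqrt_zero] at h2
  refine h2.congr fun t => ?_
  rw [Function.comp_apply, (hasSum_modeCoeff_sq _).tsum_eq, Real.sqrt_sq (norm_nonneg _)]

/-- The control acting on a mode. -/
theorem IsDelayedControl.const_mul_mode (hu : IsDelayedControl τ B u) (n : ℕ) :
    IsDelayedControl τ (√2 * B) fun t => cosMode n 1 * u t where
  zero t ht := by rw [hu.zero t ht, mul_zero]
  cont := continuousOn_const.mul hu.cont
  bound t := by
    rw [abs_mul]
    exact mul_le_mul (abs_cosMode_le n 1) (hu.bound t) (abs_nonneg _) (Real.sqrt_nonneg 2)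

/-- Majorant of the `n`-th mode of the solution on `[0,T]`. -/
noncomputable def modeBound (T B : ℝ) (θ₀ : L2) (n : ℕ) : ℝ :=
  |modeCoeff θ₀ n| + √2 * B * (1 + T) * invEigen n

theorem summable_modeBound_sq (T B : ℝ) (θ₀ : L2) : Summable fun n => modeBound T B θ₀ n ^ 2 := by
  have h1 := (hasSum_modeCoeff_sq θ₀).summable.mul_left 2
  have h2 := summable_invEigen.mul_left (2 * (√2 * B * (1 + T)) ^ 2)
  refine Summable.of_nonneg_of_le (fun n => sq_nonneg _) (fun n => ?_) (h1.add h2)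
  have h3 := invEigen_nonneg n
  have h4 := invEigen_le_one n
  have h5 : invEigen n ^ 2 ≤ invEigen n := by nlinarith
  rw [modeBound]
  set p := √2 * B * (1 + T)
  have h6 : p ^ 2 * invEigen n ^ 2 ≤ p ^ 2 * invEigen n := by gcongr
  nlinarith [sq_nonneg (|modeCoeff θ₀ n| - p * invEigen n), sq_abs (modeCoeff θ₀ n)]

theorem summable_abs_modeCoeff_of_neumann {φ : ℝ → ℝ} (hφ : ContDiff ℝ 2 φ) (h0 : deriv φ 0 = 0)
    (h1 : deriv φ 1 = 0) (hc : Continuous (deriv (deriv φ))) :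
    Summable fun n => |∫ x in Ioo (0 : ℝ) 1, φ x * cosMode n x| := by
  refine (summable_nat_add_iff 1).1 ?_
  set D := ‖(memLp_of_continuous hc).toLp _‖
  refine Summable.of_nonneg_of_le (fun n => abs_nonneg _) (fun n => ?_)
    (((summable_nat_add_iff 1).2 summable_invEigen).mul_left D)
  have h2 := abs_modeCoeff_le ((memLp_of_continuous hc).toLp _) (n + 1)
  rw [modeCoeff_toLp hc, integral_deriv_deriv_mul_cosMode hφ h0 h1, abs_mul, abs_neg,
    abs_of_nonneg (eigen_nonneg _)] at h2
  have h3 := mul_le_mul_of_nonneg_right h2 (invEigen_nonneg (n + 1))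
  have h4 := eigen_mul_invEigen n.succ_ne_zero
  calc |∫ x in Ioo (0 : ℝ) 1, φ x * cosMode (n + 1) x|
      = eigen (n + 1) * |∫ x in Ioo (0 : ℝ) 1, φ x * cosMode (n + 1) x| * invEigen (n + 1) := by
        rw [mul_right_comm, h4, one_mul]
    _ ≤ _ := h3

/-- The state is assembled from the scalar solutions `modeSol`. The weak equation follows by
expanding the test function in cosines and summing the scalar integral equations with its
coefficients as weights. -/
theorem exists_isHeatSolution (T : ℝ) (hu : IsDelayedControl τ B u) (hT : 0 < T) (θ₀ : L2) :
    ∃ θ : ℝ → L2, IsHeatSolution T u θ₀ θ := by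
  set a : ℕ → ℝ → ℝ := fun n => modeSol (eigen n) (cosMode n 1) (modeCoeff θ₀ n) u with ha
  have hac : ∀ n, Continuous (a n) := fun n => continuous_modeSol hu _ _ _
  have hai : ∀ n t, a n t = modeCoeff θ₀ n +
      ∫ r in (0 : ℝ)..t, (-eigen n * a n r + cosMode n 1 * u r) := fun n t =>
    modeSol_integral_eq hu _ _ _ t
  have hab : ∀ n, ∀ t ∈ Icc 0 T, |a n t| ≤ modeBound T B θ₀ n := fun n t ht =>
    abs_mode_le_invEigen (hu.const_mul_mode n) (hac n).continuousOn (fun t _ => hai n t) ht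
  have hbs := summable_modeBound_sq T B θ₀
  have hex : ∀ t, ∃ f : L2, t ∈ Icc 0 T → ∀ n, modeCoeff f n = a n t := by
    intro t
    by_cases ht : t ∈ Icc 0 T
    · obtain ⟨f, hf⟩ := exists_modeCoeff_eq (a := fun n => a n t)
        (Summable.of_nonneg_of_le (fun n => sq_nonneg _) (fun n => sq_le_sq'
          (by linarith [(abs_le.1 (hab n t ht)).1]) (abs_le.1 (hab n t ht)).2) hbs)
      exact ⟨f, fun _ => hf⟩
    · exact ⟨0, fun h => absurd h ht⟩
  choose θ hθ using hex
  refine ⟨θ, hu.memLp T, ?_, ?_, ?_⟩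
  · refine continuousOn_of_modeCoeff hbs (fun n => ?_) fun n t ht => ?_
    · exact (hac n).continuousOn.congr fun t ht => hθ t ht n
    · rw [hθ t ht n]; exact hab n t ht
  · refine eq_of_modeCoeff_eq fun n => ?_
    rw [hθ 0 ⟨le_rfl, hT.le⟩ n, hai]
    simp
  · intro φ hφ h0 h1 t ht
    have hφ' : ContDiff ℝ 1 (deriv φ) := by
      rw [show (2 : WithTop ℕ∞) = 1 + 1 by norm_num, contDiff_succ_iff_deriv] at hφ
      exact hφ.2.2
    have hc : Continuous (deriv (deriv φ)) := hφ'.continuous_deriv le_rfl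
    have hp := summable_abs_modeCoeff_of_neumann hφ h0 h1 hc
    have hgreen := integral_deriv_deriv_mul_cosMode hφ h0 h1
    set p : ℕ → ℝ := fun n => ∫ x in Ioo (0 : ℝ) 1, φ x * cosMode n x with hpdef
    -- Pointwise convergence at the boundary turns the control terms into `u φ(1)`.
    have hone : HasSum (fun n => p n * cosMode n 1) (φ 1) := by
      rw [eq_cosSeries hφ.continuous hp (right_mem_Icc.2 zero_le_one)]
      refine Summable.hasSum (Summable.of_norm_bounded (hp.mul_right √2) fun n => ?_)
      rw [norm_mul]
      exact mul_le_mul_of_nonneg_left (abs_cosMode_le n 1) (abs_nonneg _)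
    have hsub : ∀ r ∈ uIoc 0 t, r ∈ Icc 0 T := fun r hr => by
      rw [uIoc_of_le ht.1] at hr
      exact ⟨hr.1.le, hr.2.trans ht.2⟩
    -- Both factors are square summable, the first because `φ''` is in `L²`; this dominates the sum
    -- under the time integral.
    have hq : Summable fun n => |eigen n * p n| * modeBound T B θ₀ n := by
      have hs := (hasSum_modeCoeff_sq ((memLp_of_continuous hc).toLp _)).summable
      simp only [modeCoeff_toLp hc, hgreen] at hs
      refine Summable.of_norm_bounded (hs.add hbs) fun n => ?_
      rw [norm_mul, Real.norm_eq_abs, Real.norm_eq_abs, abs_abs]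
      have := two_mul_le_add_sq |eigen n * p n| |modeBound T B θ₀ n|
      rw [sq_abs, sq_abs] at this
      have h5 : (-eigen n * p n) ^ 2 = (eigen n * p n) ^ 2 := by ring
      rw [h5]
      nlinarith [mul_nonneg (abs_nonneg (eigen n * p n)) (abs_nonneg (modeBound T B θ₀ n))]
    have hsum := intervalIntegral.hasSum_integral_of_dominated_convergence (μ := volume)
      (a := 0) (b := t) (F := fun n r => p n * (-eigen n * a n r + cosMode n 1 * u r))
      (f := fun r => (∫ x in Ioo (0 : ℝ) 1, θ r x * deriv (deriv φ) x) + u r * φ 1)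
      (fun n _ => |eigen n * p n| * modeBound T B θ₀ n + |p n| * (√2 * B))
      (fun n => (continuous_const.aestronglyMeasurable.mul
        ((continuous_const.mul (hac n)).aestronglyMeasurable.add
          (continuous_const.aestronglyMeasurable.mul hu.aestronglyMeasurable))).restrict)
      (fun n => Eventually.of_forall fun r hr => by
        have h2 := hab n r (hsub r hr)
        have h3 := (hu.const_mul_mode n).bound r
        rw [show p n * (-eigen n * a n r + cosMode n 1 * u r) =
          -(eigen n * p n * a n r) + p n * (cosMode n 1 * u r) by ring]
        refine (norm_add_le _ _).trans (add_le_add ?_ ?_)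
        · rw [norm_neg, norm_mul]
          exact mul_le_mul_of_nonneg_left h2 (abs_nonneg _)
        · rw [norm_mul]
          exact mul_le_mul_of_nonneg_left h3 (abs_nonneg _))
      (Eventually.of_forall fun r _ => hq.add (hp.mul_right _))
      (by simp)
      (Eventually.of_forall fun r hr => by
        have h2 := hasSum_modeCoeff_mul (θ r) hc
        simp only [hgreen, hθ r (hsub r hr)] at h2
        have e : ∀ n, p n * (-eigen n * a n r + cosMode n 1 * u r) =
            a n r * (-eigen n * p n) + u r * (p n * cosMode n 1) := fun n => by ring
        simp only [e]
        exact h2.add (hone.mul_left (u r)))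
    simp only [intervalIntegral.integral_const_mul] at hsum
    have hmode : ∀ n, ∫ r in (0 : ℝ)..t, (-eigen n * a n r + cosMode n 1 * u r) =
        a n t - modeCoeff θ₀ n := fun n => by rw [hai n t]; ring
    simp only [hmode] at hsum
    have hl := hasSum_modeCoeff_mul (θ t) hφ.continuous
    have hr := hasSum_modeCoeff_mul θ₀ hφ.continuous
    simp only [hθ t ht] at hl
    have e : ∀ n, p n * (a n t - modeCoeff θ₀ n) = a n t * p n - modeCoeff θ₀ n * p n :=
      fun n => by ring
    simp only [e] at hsum
    have h7 := hsum.unique (hl.sub hr)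
    rw [h7]
    ring

/-- Cosines are admissible test functions, so any solution, not only the constructed one, obeys the
scalar equations. -/
theorem modeCoeff_isHeatSolution {T : ℝ} {θ₀ : L2} {θ : ℝ → L2}
    (hθ : IsHeatSolution T u θ₀ θ) (n : ℕ) :
    ContinuousOn (fun t => modeCoeff (θ t) n) (Icc 0 T) ∧
      ∀ t ∈ Icc (0 : ℝ) T, modeCoeff (θ t) n = modeCoeff θ₀ n +
        ∫ r in (0 : ℝ)..t, (-eigen n * modeCoeff (θ r) n + cosMode n 1 * u r) := by
  constructor
  · simp only [← inner_cosBasis]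
    exact continuousOn_const.inner hθ.continuousOn
  · intro t ht
    have h := hθ.weak (cosMode n) (contDiff_cosMode n) (deriv_cosMode_zero n)
      (deriv_cosMode_one n) t ht
    simp only [deriv_deriv_cosMode, mul_left_comm _ (-eigen n), integral_const_mul,
      mul_comm (u _)] at h
    exact h

/-- The sup-norm distance of two solutions is controlled by that of the controls. -/
theorem eLpNorm_sub_le {T B' ε : ℝ} {u' : ℝ → ℝ} {θ₀ : L2} {θ θ' : ℝ → L2}
    (hu : IsDelayedControl τ B u) (hu' : IsDelayedControl τ B' u')
    (hε : ∀ t, |u t - u' t| ≤ ε) (hθ : IsHeatSolution T u θ₀ θ)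
    (hθ' : IsHeatSolution T u' θ₀ θ') {t : ℝ} (ht : t ∈ Icc 0 T) :
    eLpNorm (fun x => θ t x - θ' t x) ⊤ unitMeasure ≤
      ENNReal.ofReal (2 * (1 + T) * (∑' n, invEigen n) * ε) := by
  have hT : 0 ≤ T := ht.1.trans ht.2
  have hε0 : 0 ≤ ε := (abs_nonneg _).trans (hε 0)
  have hd : IsDelayedControl τ ε fun t => u t - u' t :=
    ⟨fun t ht => by rw [hu.zero t ht, hu'.zero t ht, sub_zero], hu.cont.sub hu'.cont, hε⟩
  have hcoef : ∀ n, |modeCoeff (θ t - θ' t) n| ≤ √2 * ε * (1 + T) * invEigen n := by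
    intro n
    obtain ⟨c1, e1⟩ := modeCoeff_isHeatSolution hθ n
    obtain ⟨c2, e2⟩ := modeCoeff_isHeatSolution hθ' n
    -- Both solutions share the initial state, so the modes of the difference start from `0`.
    have := abs_mode_le_invEigen (w₀ := 0) (n := n) (hd.const_mul_mode n)
      (w := fun t => modeCoeff (θ t) n - modeCoeff (θ' t) n) (c1.sub c2) (fun r hr => ?_) ht
    · rw [modeCoeff_sub]; simpa using this
    · have hsub : uIcc 0 r ⊆ Icc 0 T := by
        rw [uIcc_of_le hr.1]; exact Icc_subset_Icc_right hr.2
      have i1 : IntervalIntegrable (fun r => -eigen n * modeCoeff (θ r) n + cosMode n 1 * u r)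
          volume 0 r := ((continuousOn_const.mul (c1.mono hsub)).intervalIntegrable).add
        ((hu.intervalIntegrable _ _).const_mul _)
      have i2 : IntervalIntegrable (fun r => -eigen n * modeCoeff (θ' r) n + cosMode n 1 * u' r)
          volume 0 r := ((continuousOn_const.mul (c2.mono hsub)).intervalIntegrable).add
        ((hu'.intervalIntegrable _ _).const_mul _)
      rw [e1 r hr, e2 r hr, add_sub_add_left_eq_sub, ← intervalIntegral.integral_sub i1 i2, zero_add]
      congr 1
      ext x
      ring
  have hinv := summable_invEigen
  have hsum : Summable fun n => |modeCoeff (θ t - θ' t) n| :=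
    Summable.of_nonneg_of_le (fun n => abs_nonneg _) hcoef (hinv.mul_left _)
  have hae := ae_eq_cosSeries hsum
  have hle : ∀ᵐ x ∂unitMeasure, ‖θ t x - θ' t x‖ ≤ 2 * (1 + T) * (∑' n, invEigen n) * ε := by
    filter_upwards [hae, Lp.coeFn_sub (θ t) (θ' t)] with x hx hx'
    rw [hx', Pi.sub_apply] at hx
    rw [hx]
    refine (tsum_of_norm_bounded (f := fun n => modeCoeff (θ t - θ' t) n * cosMode n x)
      ((hinv.hasSum.mul_left (2 * (1 + T) * ε))) fun n => ?_).trans_eq (by ring)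
    have h2 : √2 * √2 = 2 := Real.mul_self_sqrt (by norm_num)
    rw [norm_mul]
    calc _ ≤ √2 * ε * (1 + T) * invEigen n * √2 :=
          mul_le_mul (hcoef n) (abs_cosMode_le n x) (abs_nonneg _)
            ((abs_nonneg _).trans (hcoef n))
      _ = _ := by linear_combination (ε * (1 + T) * invEigen n) * h2
  refine (eLpNorm_le_of_ae_bound hle).trans ?_
  simp

end HeatFlat

/-! ### The truncation estimate -/

theorem corollary3 (T τ R' s : ℝ) (hτ : 0 < τ) (hR' : 0 < R') (hR'τ : R' < τ) (hT : τ + R' ≤ T)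
    (hs₁ : 1 < s) (hs₂ : s < 2) :
    ∃ C C₁ C₂ C₃ : ℝ, 0 < C ∧ 0 < C₁ ∧ 0 < C₂ ∧ 0 < C₃ ∧
      ∀ θ₀ : HeatFlat.L2,
        HeatFlat.ControlWellDefined T s τ R' θ₀ ∧
        (∃ θ : ℝ → HeatFlat.L2,
          HeatFlat.IsHeatSolution T (HeatFlat.control s τ R' θ₀) θ₀ θ) ∧
        ∀ I K N : ℕ,
          (∃ θ' : ℝ → HeatFlat.L2,
            HeatFlat.IsHeatSolution T (HeatFlat.truncControl s τ R' θ₀ I K N) θ₀ θ') ∧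
          ∀ θ θ' : ℝ → HeatFlat.L2,
            HeatFlat.IsHeatSolution T (HeatFlat.control s τ R' θ₀) θ₀ θ →
            HeatFlat.IsHeatSolution T (HeatFlat.truncControl s τ R' θ₀ I K N) θ₀ θ' →
            ∀ t ∈ Set.Icc τ T,
              MeasureTheory.eLpNorm (fun x => θ t x - θ' t x) ⊤ HeatFlat.unitMeasure ≤
                ENNReal.ofReal
                  (C * (Real.exp (-C₁ * ((I : ℝ) * Real.log (I : ℝ))) +
                        Real.exp (-C₂ * (K : ℝ)) + Real.exp (-C₃ * (N : ℝ) ^ 2)) * ‖θ₀‖) := by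
  obtain ⟨B, C, C₁, C₂, C₃, hC, hC₁, hC₂, hC₃, h⟩ :=
    HeatFlat.control_estimates (T := T) hR' hR'τ hs₁ hs₂
  have hT0 : 0 < T := by linarith
  have hinv : 0 < ∑' n, HeatFlat.invEigen n :=
    HeatFlat.summable_invEigen.tsum_pos HeatFlat.invEigen_nonneg 0 (by simp [HeatFlat.invEigen])
  refine ⟨2 * (1 + T) * (∑' n, HeatFlat.invEigen n) * C, C₁, C₂, C₃, by positivity, hC₁, hC₂, hC₃,
    fun θ₀ => ?_⟩
  obtain ⟨hwd, hb, hcont, htrunc⟩ := h θ₀ ‖θ₀‖ (HeatFlat.abs_cosCoeff_le θ₀)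
  have hu : HeatFlat.IsDelayedControl τ (B * ‖θ₀‖) (HeatFlat.control s τ R' θ₀) :=
    ⟨fun t ht => if_pos ht, hcont, hb⟩
  refine ⟨hwd, HeatFlat.exists_isHeatSolution T hu hT0 θ₀, fun I K N => ?_⟩
  obtain ⟨hcont', hdiff⟩ := htrunc I K N
  set ε := C * (Real.exp (-C₁ * ((I : ℝ) * Real.log (I : ℝ))) +
    Real.exp (-C₂ * (K : ℝ)) + Real.exp (-C₃ * (N : ℝ) ^ 2)) * ‖θ₀‖ with hε
  -- The bound on the truncated control comes from the exact one by the triangle inequality; its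
  -- size does not enter the final estimate.
  have hu' : HeatFlat.IsDelayedControl τ (B * ‖θ₀‖ + ε)
      (HeatFlat.truncControl s τ R' θ₀ I K N) := by
    refine ⟨fun t ht => if_pos ht, hcont', fun t => ?_⟩
    have h1 := abs_sub (HeatFlat.control s τ R' θ₀ t)
      (HeatFlat.control s τ R' θ₀ t - HeatFlat.truncControl s τ R' θ₀ I K N t)
    rw [sub_sub_cancel] at h1
    linarith [hb t, hdiff t]
  refine ⟨HeatFlat.exists_isHeatSolution T hu' hT0 θ₀, fun θ θ' hθ hθ' t ht => ?_⟩
  refine (HeatFlat.eLpNorm_sub_le hu hu' hdiff hθ hθ' ⟨hτ.le.trans ht.1, ht.2⟩).trans_eq ?_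
  congr 1
  rw [hε]
  ring
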